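/- **Policies.** Fix sets of actors $a$ and locks $\sigma$. A *clause* $\Sigma\Rightarrow a$ is a lock set $\Sigma$ (an arbitrary set of locks) with an actor $a$; a *policy* $p$ is a set of clauses. Put $p\sqsubseteq q$ if for every $(\Sigma_2\Rightarrow a)\in q$ there is $(\Sigma_1\Rightarrow a)\in p$ with $\Sigma_1\subseteq\Sigma_2$; $\bot=\{\emptyset\Rightarrow a\mid a \text{ an actor}\}$; $p\sqcup q=\{\Sigma_1\cup\Sigma_2\Rightarrow a\mid(\Sigma_1\Rightarrow a)\in p,(\Sigma_2\Rightarrow a)\in q\}$; $p|_\Sigma=\{\Sigma_1\setminus\Sigma\Rightarrow a\mid(\Sigma_1\Rightarrow a)\in p\}$. A function $\mathsf L$ assigning a policy $\mathsf L(\sigma)$ to every lock is fixed. An *attacker* $\mathcal A=(a,\Sigma_{\mathcal A})$ is an actor with a lock set; it is identified with the policy $\{\Sigma_{\mathcal A}\Rightarrow a\}$. For a lock set, $\Sigma\sqsubseteq\mathcal A$ means $\Sigma\subseteq\Sigma_{\mathcal A}$. Write $\Sigma\approx_{\mathcal A}\Sigma'$ if $\{\sigma\in\Sigma\mid\mathsf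 L(\sigma)\sqsubseteq\mathcal A\}=\{\sigma\in\Sigma'\mid\mathsf L(\sigma)\sqsubseteq\mathcal A\}$. **Syntax of λ-WHR.** Types $A::=\mathsf{unit}\mid\mathsf{nat}\mid\tau+\tau'\mid\tau\times\tau'\mid\mathsf{ref}\,\tau\mid\tau\xrightarrow{\Sigma,pc}\tau'$; annotated types $\tau::=A^p$. For $\tau=A^p$, $p'\sqsubseteq\tau$ and $\tau\sqsubseteq p'$ mean $p'\sqsubseteq p$ and $p\sqsubseteq p'$, and $\tau|_\Sigma=A^{p|_\Sigma}$. Expressions, up to renaming of bound variables: $$e::=x\mid()\mid n\mid\lambda x.e\mid(e,e')\mid\mathsf{fst}\,e\mid\mathsf{snd}\,e\mid\mathsf{inl}\,e\mid\mathsf{inr}\,e\mid\mathsf{case}\,e\,(x.e')(y.e'')\mid e\,e'\mid\mathsf{new}(e,\tau)\mid{!e}\mid e:=e'\mid\mathsf{open}_\sigma e\mid\mathsf{opened}_\sigma e\mid\mathsf{close}_\sigma e\mid\mathsf{closed}_\sigma e\mid\mathsf{when}_\sigma\,e\,e'\mid l$$ with $n\in\mathbb N$ and $l$ in a countably infinite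 set of locations. Values: $v::=\lambda x.e\mid(v,v')\mid\mathsf{inl}\,v\mid\mathsf{inr}\,v\mid()\mid l\mid n$; $\mathcal V$ is the set of values. **Semantics.** A *state* $S$ is a finite partial map from locations to pairs of a value and a type; if $l\mapsto(v,\tau)\in S$ then $S(l)=v$ and $\mathrm{type}(S,l)=\tau$. *Observations* are $\epsilon$, $l_\tau(v)$ (write), $\mathsf{open}(\sigma)$, $\mathsf{unopen}(\sigma)$, $\mathsf{close}(\sigma)$, $\mathsf{unclose}(\sigma)$. $\mathrm{pol}(l_{A^p}(v))=p$, $\mathrm{pol}$ of the four lock observations is $\mathsf L(\sigma)$, $\mathrm{pol}(\epsilon)$ is undefined; $\mathrm{pol}(\omega)\sqsubseteq\mathcal A$ is false for $\omega=\epsilon$. A step $e,\Sigma,S\to e',S',\omega,\Sigma'$ says that $e$, with open locks $\Sigma$ in state $S$, reduces to $e'$ and $S'$ with observation $\omega$ and active lock set $\Sigma'$. Axioms (active lock set $\Sigma$; state unchanged unless stated): - $\mathsf{open}_\sigma e\to\mathsf{opened}_\sigma e$ with $\mathsf{open}(\sigma)$; $\mathsf{opened}_\sigma v\to v$ with $\mathsf{unopen}(\sigma)$;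 $\mathsf{close}_\sigma e\to\mathsf{closed}_\sigma e$ with $\mathsf{close}(\sigma)$; $\mathsf{closed}_\sigma v\to v$ with $\mathsf{unclose}(\sigma)$; - with $\epsilon$: $!l\to S(l)$ if $l\in\mathrm{dom}(S)$; $(\lambda x.e)\,v\to[v/x]e$; $\mathsf{fst}(v,v')\to v$; $\mathsf{snd}(v,v')\to v'$; $\mathsf{case}(\mathsf{inl}\,v)(x.e')(y.e'')\to[v/x]e'$; $\mathsf{case}(\mathsf{inr}\,v)(x.e')(y.e'')\to[v/y]e''$; $\mathsf{when}_\sigma v\,e'\to v$ if $\sigma\in\Sigma$; $\mathsf{when}_\sigma e\,v\to v$ if $\sigma\notin\Sigma$; - $\mathsf{new}(v,\tau)\to l$ for any $l\notin\mathrm{dom}(S)$, with $l_\tau(v)$ and new state $S\cup\{l\mapsto(v,\tau)\}$; $l:=v\to()$ if $l\in\mathrm{dom}(S)$ and $\tau=\mathrm{type}(S,l)$, with $l_\tau(v)$ and new state $S[l\mapsto(v,\tau)]$. A step of a subexpression $e$ with open locks $\Sigma$ gives the step of the whole expression with the same state change, observation and active lock set in the contexts $\mathsf{new}(e,\tau)$,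 $!e$, $e:=e'$, $l:=e$, $e\,e'$, $(\lambda x.e')\,e$, $(e,e')$, $(v,e)$, $\mathsf{fst}\,e$, $\mathsf{snd}\,e$, $\mathsf{inl}\,e$, $\mathsf{inr}\,e$, $\mathsf{case}\,e\,(x.e')(y.e'')$, $\mathsf{when}_\sigma e\,e'$ if $\sigma\in\Sigma$, and $\mathsf{when}_\sigma e'\,e$ if $\sigma\notin\Sigma$. A step of $e$ with open locks $\Sigma\cup\{\sigma\}$ (resp. $\Sigma\setminus\{\sigma\}$) gives in the same way a step of $\mathsf{opened}_\sigma e$ (resp. $\mathsf{closed}_\sigma e$) with open locks $\Sigma$. **Subtyping.** $A^p<:B^{p'}$ if $p\sqsubseteq p'$ and $A<:B$. $\mathsf{unit}$, $\mathsf{nat}$ and $\mathsf{ref}\,\tau$ are subtypes of themselves; $\times$ and $+$ are covariant in both components; $(\tau_1\xrightarrow{\Sigma,p}\tau_2)<:(\tau_1'\xrightarrow{\Sigma',p'}\tau_2')$ if $\tau_1'<:\tau_1$, $\tau_2<:\tau_2'$, $p'\sqsubseteq p$ and $\Sigma\subseteq\Sigma'$. **Typing.** A state environment $\theta$ is a partial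 map from locations to annotated types, a context $\Gamma$ assigns annotated types to variables. $\Gamma;\Sigma;\theta\vdash_{pc}e:\tau$ is generated by the following rules, where $\vdash_{pc}$ without further decoration means $\Gamma;\Sigma;\theta\vdash_{pc}$. - $\vdash_{pc}x:\Gamma(x)$; $\vdash_{pc}():\mathsf{unit}^\bot$; $\vdash_{pc}n:\mathsf{nat}^\bot$; $\vdash_{pc}l:(\mathsf{ref}\,\theta(l))^\bot$ for $l\in\mathrm{dom}(\theta)$. - $\vdash_{pc}\lambda x.e:(\tau_1\xrightarrow{\Sigma',pc'}\tau_2)^\bot$ if $\Gamma,x:\tau_1;\Sigma';\theta\vdash_{pc'}e:\tau_2$. - $\vdash_{pc}\mathsf{open}_\sigma e:\tau$ and $\vdash_{pc}\mathsf{opened}_\sigma e:\tau$ if $\Gamma;\Sigma\cup\{\sigma\};\theta\vdash_{pc}e:\tau$ and $pc\sqsubseteq\mathsf L(\sigma)$; likewise $\mathsf{close}_\sigma e$, $\mathsf{closed}_\sigma e$ with $\Sigma\setminus\{\sigma\}$. - $\vdash_{pc}(e_1,e_2):(\tau_1\times\tau_2)^\bot$ if $\vdash_{pc}e_i:\tau_i$;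 $\vdash_{pc}\mathsf{fst}\,e:\tau_1$ if $\vdash_{pc}e:(\tau_1\times\tau_2)^p$ and $p\sqsubseteq\tau_1$; symmetrically $\mathsf{snd}$. - $\vdash_{pc}\mathsf{inl}\,e:(\tau_1+\tau_2)^\bot$ if $\vdash_{pc}e:\tau_1$; $\vdash_{pc}\mathsf{inr}\,e:(\tau_1+\tau_2)^\bot$ if $\vdash_{pc}e:\tau_2$. - $\vdash_{pc}\mathsf{case}\,e\,(x.e_1)(y.e_2):\tau$ if $\vdash_{pc}e:(\tau_1+\tau_2)^p$, $p\sqsubseteq\tau$, $\Gamma,x:\tau_1;\Sigma;\theta\vdash_{pc\sqcup p}e_1:\tau$ and $\Gamma,y:\tau_2;\Sigma;\theta\vdash_{pc\sqcup p}e_2:\tau$. - $\vdash_{pc}e:\tau$ if $\vdash_{pc'}e:\tau'$, $pc\sqsubseteq pc'$, $\tau'<:\tau$. - $\vdash_{pc}e_1\,e_2:\tau_2$ if $\vdash_{pc}e_1:(\tau_1\xrightarrow{\Sigma',pc'}\tau_2)^p$, $\vdash_{pc}e_2:\tau_1'$, $p\sqsubseteq\tau_2$, $pc\sqcup p\sqsubseteq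 pc'$, $\tau_1'<:\tau_1$, $\Sigma'\subseteq\Sigma$. - $\vdash_{pc}{!e}:\tau'$ if $\vdash_{pc}e:(\mathsf{ref}\,\tau)^p$, $p\sqsubseteq\tau'$, $\tau<:\tau'$. - $\vdash_{pc}\mathsf{new}(e,\tau):(\mathsf{ref}\,\tau)^\bot$ if $\vdash_{pc}e:\tau'$, $pc\sqsubseteq\tau$, $\tau'|_\Sigma<:\tau$. - $\vdash_{pc}e:=e':\mathsf{unit}^\bot$ if $\vdash_{pc}e:(\mathsf{ref}\,\tau')^p$, $\vdash_{pc}e':\tau$, $\tau|_\Sigma<:\tau'$, $pc\sqcup p\sqsubseteq\tau'$. - $\vdash_{pc}\mathsf{when}_\sigma e_1\,e_2:\tau$ if $\Gamma;\Sigma\cup\{\sigma\};\theta\vdash_{pc\sqcup\mathsf L(\sigma)}e_1:\tau$, $\Gamma;\Sigma;\theta\vdash_{pc\sqcup\mathsf L(\sigma)}e_2:\tau$ and $\mathsf L(\sigma)\sqsubseteq\tau$. **Unary relation** (by recursion on the step index $m\in\mathbb N$ and the type). $\theta'\sqsupseteq\theta$ means that $\theta'$ extends $\theta$ as a partial map.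 $(S,m)\triangleright\theta$ means: every $l\in\mathrm{dom}(\theta)$ lies in $\mathrm{dom}(S)$, with $\mathrm{type}(S,l)=\theta(l)$ and $(S(l),\theta,m)\in\lfloor\theta(l)\rfloor_{\mathcal V}$. $\lfloor A^p\rfloor_{\mathcal V}=\lfloor A\rfloor_{\mathcal V}$, and $(v,\theta,m)\in\lfloor A\rfloor_{\mathcal V}$ holds iff - $A=\mathsf{unit}$: $v=()$; $A=\mathsf{nat}$: $v\in\mathbb N$; $A=\mathsf{ref}\,\tau$: $v$ is a location $l$ with $\theta(l)=\tau$; - $A=\tau_1\times\tau_2$: $v=(v_1,v_2)$ with $(v_i,\theta,m)\in\lfloor\tau_i\rfloor_{\mathcal V}$; $A=\tau_1+\tau_2$: $v=\mathsf{inl}\,w$ with $(w,\theta,m)\in\lfloor\tau_1\rfloor_{\mathcal V}$ or $v=\mathsf{inr}\,w$ with $(w,\theta,m)\in\lfloor\tau_2\rfloor_{\mathcal V}$; - $A=\tau_1\xrightarrow{\Sigma,pc}\tau_2$: $v=\lambda x.e$ and for all $\theta'\sqsupseteq\theta$, $m'<m$ and $(w,\theta',m')\in\lfloor\tau_1\rfloor_{\mathcal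 V}$, $([w/x]e,\theta',m')\in\lfloor\tau_2\rfloor_E^{pc}$. $(e,\theta,m)\in\lfloor\tau\rfloor_E^{pc}$ iff $(e,\theta,m)\in\lfloor\tau\rfloor_{\mathcal V}$, or $e\notin\mathcal V$ and for all $S,\theta'\sqsupseteq\theta,m'<m,e',S',\omega,\Sigma,\Sigma'$ with $(S,m')\triangleright\theta'$ and $e,\Sigma,S\to e',S',\omega,\Sigma'$: ($\omega=\epsilon$ or $pc\sqsubseteq\mathrm{pol}(\omega)$), and there is $\theta''\sqsupseteq\theta'$ with $(S',m')\triangleright\theta''$ and $(e',\theta'',m')\in\lfloor\tau\rfloor_E^{pc}$. **Binary relation.** A *world* $W=(\theta_1,\theta_2,\beta)$ consists of two state environments and a partial bijection (injective partial function) $\beta$ between locations. $W'\sqsupseteq W$ if $W'.\theta_i\sqsupseteq W.\theta_i$ for $i=1,2$ and $W.\beta\subseteq W'.\beta$. $(S_1,S_2,m)\triangleright^{\mathcal A}W$ (state indistinguishability) means: $(S_i,m)\triangleright W.\theta_i$ for $i=1,2$; $W.\beta\subseteq\mathrm{dom}(W.\theta_1)\times\mathrm{dom}(W.\theta_2)$;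 and for all $(l_1,l_2)\in W.\beta$, $W.\theta_1(l_1)=W.\theta_2(l_2)$ and $(S_1(l_1),S_2(l_2),W,m)\in\lceil W.\theta_1(l_1)\rceil_{\mathcal V}^{\mathcal A}$. $(v,v',W,m)\in\lceil A^p\rceil^{\mathcal A}_{\mathcal V}$ iff either $p\sqsubseteq\mathcal A$ and $(v,v',W,m)\in\lceil A\rceil^{\mathcal A}_{\mathcal V}$, or $p\not\sqsubseteq\mathcal A$ and $(v,W.\theta_1,m),(v',W.\theta_2,m)\in\lfloor A\rfloor_{\mathcal V}$. $(v,v',W,m)\in\lceil A\rceil^{\mathcal A}_{\mathcal V}$ iff - $A=\mathsf{unit}$: $v=v'=()$; $A=\mathsf{nat}$: $v=v'\in\mathbb N$; $A=\mathsf{ref}\,\tau$: $v=l$, $v'=l'$ are locations with $W.\theta_1(l)=\tau=W.\theta_2(l')$ and $(l,l')\in W.\beta$; - $A=\tau_1\times\tau_2$: $v,v'$ are pairs with components related at $\tau_1$ and $\tau_2$ (at $W,m$); $A=\tau_1+\tau_2$: both are $\mathsf{inl}$ of values related at $\tau_1$, or both are $\mathsf{inr}$ of values related at $\tau_2$; -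 $A=\tau_1\xrightarrow{\Sigma,pc}\tau_2$: $v=\lambda x.e_1$, $v'=\lambda x.e_2$; for all $W'\sqsupseteq W$, $m'<m$, $(v_1,v_2,W',m')\in\lceil\tau_1\rceil^{\mathcal A}_{\mathcal V}$ and $\Sigma_1,\Sigma_2\supseteq\Sigma$ with $\Sigma_1\approx_{\mathcal A}\Sigma_2$, $([v_1/x]e_1,[v_2/x]e_2,W',\Sigma_1,\Sigma_2,m')\in\lceil\tau_2\rceil_E^{\mathcal A}$; and $(v,W.\theta_1,m),(v',W.\theta_2,m)\in\lfloor A\rfloor_{\mathcal V}$. *Observational indistinguishability* $\omega\simeq_{W,m}\omega'$ holds iff neither $\mathrm{pol}(\omega)\sqsubseteq\mathcal A$ nor $\mathrm{pol}(\omega')\sqsubseteq\mathcal A$; or $\omega=\omega'$ is not a write; or $\omega=l_\tau(v)$, $\omega'=l'_\tau(v')$ with $(v,v',W,m)\in\lceil\tau\rceil^{\mathcal A}_{\mathcal V}$ and $(l,l')\in W.\beta$. *Observational irrelevance* $\omega\equiv_{W,m}\omega'$ holds iff not both $\mathrm{pol}(\omega)\sqsubseteq\mathcal A$ and $\mathrm{pol}(\omega')\sqsubseteq\mathcal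 A$; or $\omega=\omega'$ is not a write; or $\omega=l_\tau(v)$, $\omega'=l'_\tau(v')$ with $(v,v',W,m)\in\lceil\tau\rceil^{\mathcal A}_{\mathcal V}$. $(e_1,e_2,W,\Sigma,\Sigma',m)\in\lceil\tau\rceil_E^{\mathcal A}$ iff $(e_1,e_2,W,m)\in\lceil\tau\rceil^{\mathcal A}_{\mathcal V}$, or $\Sigma\approx_{\mathcal A}\Sigma'$ and for all $\Sigma_1\supseteq\Sigma$, $\Sigma_2\supseteq\Sigma'$ with $\Sigma_1\approx_{\mathcal A}\Sigma_2$, all $W'\sqsupseteq W$, $m'<m$ and $S_1,S_2$ with $(S_1,S_2,m')\triangleright^{\mathcal A}W'$, at least one of the following holds: - (Par) $e_1,e_2\notin\mathcal V$, and for all steps $e_1,\Sigma_1,S_1\to e_1',S_1',\omega,\Sigma_1'$ and $e_2,\Sigma_2,S_2\to e_2',S_2',\omega',\Sigma_2'$ such that $\omega\equiv_{W',m'}\omega'$ or $\Sigma_1'\sqsubseteq\mathcal A$ or $\Sigma_2'\sqsubseteq\mathcal A$, there is $W''\sqsupseteq W'$ with $(S_1',S_2',m')\triangleright^{\mathcal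 A}W''$, $\omega\simeq_{W'',m'}\omega'$ and $(e_1',e_2',W'',\Sigma,\Sigma',m')\in\lceil\tau\rceil^{\mathcal A}_E$; - (L) $e_1\notin\mathcal V$, and for every step $e_1,\Sigma_1,S_1\to e_1',S_1',\omega,\Sigma_1'$, not $\mathrm{pol}(\omega)\sqsubseteq\mathcal A$, and there is $W''\sqsupseteq W'$ with $(S_1',S_2,m')\triangleright^{\mathcal A}W''$ and $(e_1',e_2,W'',\Sigma,\Sigma',m')\in\lceil\tau\rceil^{\mathcal A}_E$; - (R) the mirror image of (L) for steps of $e_2$ with open locks $\Sigma_2$ in $S_2$. **Security.** An expression $e$ with free variables in $\Gamma$ and locations in $\theta$ is *secure at type $\tau$ with program counter $pc$ under open locks $\Sigma$* if for every attacker $\mathcal A$, step index $m$, world $W\sqsupseteq(\theta,\theta,\mathrm{id}_{\mathrm{dom}(\theta)})$ and pair of substitutions $\gamma=(\gamma_1,\gamma_2)$ such that $(\gamma_1(x),\gamma_2(x),W,m)\in\lceil\Gamma(x)\rceil^{\mathcal A}_{\mathcal V}$ for every $x\in\mathrm{dom}(\Gamma)$, $$(\gamma_1(e),\gamma_2(e),W,\Sigma,\Sigma,m)\in\lceil\tau\rceil_E^{\mathcal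 A}\ \wedge\ (\gamma_1(e),W.\theta_1,m)\in\lfloor\tau\rfloor_E^{pc}\ \wedge\ (\gamma_2(e),W.\theta_2,m)\in\lfloor\tau\rfloor_E^{pc}.$$ **Theorem (Security).** If $\Gamma;\Sigma;\theta\vdash_{pc}e:\tau$, then $e$ is secure at type $\tau$ with program counter $pc$ under open locks $\Sigma$. -/

import Mathlib

universe u v

namespace WHR

/-! ### Policies -/

/-- A clause `locks ⇒ actor`. -/
structure Clause (Actor : Type u) (Lock : Type v) where
  locks : Set Lock
  actor : Actor

/-- A policy is a set of clauses. -/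
abbrev Policy (Actor : Type u) (Lock : Type v) := Set (Clause Actor Lock)

/-- `P ⊑ Q`: every clause of `Q` has a less restrictive clause in `P`. -/
def Policy.Le {Actor : Type u} {Lock : Type v} (P Q : Policy Actor Lock) : Prop :=
  ∀ c ∈ Q, ∃ d ∈ P, d.actor = c.actor ∧ d.locks ⊆ c.locks

infix:50 " ⊑ " => Policy.Le

/-- The least restrictive policy: every actor may observe, whatever locks are open. -/
def Policy.bot {Actor : Type u} {Lock : Type v} : Policy Actor Lock :=
  {c | c.locks = ∅}

def Policy.join {Actor : Type u} {Lock : Type v} (P Q : Policy Actor Lock) :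
    Policy Actor Lock :=
  {c | ∃ d₁ ∈ P, ∃ d₂ ∈ Q,
    d₁.actor = c.actor ∧ d₂.actor = c.actor ∧ c.locks = d₁.locks ∪ d₂.locks}

/-- The effective policy when the locks in `K` are open. -/
def Policy.specialize {Actor : Type u} {Lock : Type v} (P : Policy Actor Lock)
    (K : Set Lock) : Policy Actor Lock :=
  {c | ∃ d ∈ P, d.actor = c.actor ∧ c.locks = d.locks \ K}

/-- An attacker: an actor together with a capability (the locks it can open forcibly). -/
structure Attacker (Actor : Type u) (Lock : Type v) where
  actor : Actor
  locks : Set Lock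

/-- The attacker seen as the policy `{locks ⇒ actor}`. -/
def Attacker.policy {Actor : Type u} {Lock : Type v} (A : Attacker Actor Lock) :
    Policy Actor Lock :=
  {⟨A.locks, A.actor⟩}

/-- Low equivalence of lock sets: the same attacker-visible locks are open. -/
def LockEquiv {Actor : Type u} {Lock : Type v} (L : Lock → Policy Actor Lock)
    (A : Attacker Actor Lock) (K K' : Set Lock) : Prop :=
  {σ ∈ K | L σ ⊑ A.policy} = {σ ∈ K' | L σ ⊑ A.policy}

/-! ### Types and expressions -/

mutual
/-- Types. -/
inductive AType (Actor : Type u) (Lock : Type v) : Type (max u v) where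
  | unit : AType Actor Lock
  | nat : AType Actor Lock
  | sum (τ₁ τ₂ : Ty Actor Lock) : AType Actor Lock
  | prod (τ₁ τ₂ : Ty Actor Lock) : AType Actor Lock
  | ref (τ : Ty Actor Lock) : AType Actor Lock
  /-- Functions from `τ₁` to `τ₂` that need the locks `K` open and whose effects are
  bounded below by `pc`. -/
  | arrow (K : Set Lock) (pc : Policy Actor Lock) (τ₁ τ₂ : Ty Actor Lock) : AType Actor Lock
/-- Types annotated with a policy. -/
inductive Ty (Actor : Type u) (Lock : Type v) : Type (max u v) where
  | ann (B : AType Actor Lock) (P : Policy Actor Lock) : Ty Actor Lock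
end

def Ty.policy {Actor : Type u} {Lock : Type v} : Ty Actor Lock → Policy Actor Lock
  | .ann _ P => P

def Ty.specialize {Actor : Type u} {Lock : Type v} : Ty Actor Lock → Set Lock → Ty Actor Lock
  | .ann B P, K => .ann B (P.specialize K)

/-- Memory locations: a countably infinite set. -/
abbrev Loc := ℕ

/-- Expressions up to renaming of bound variables: variables are de Bruijn indices, and `lam`
and each of the two branches of `caseOf` bind index `0`. -/
inductive Expr (Actor : Type u) (Lock : Type v) : Type (max u v) where
  | var (x : ℕ)
  | unit
  | nat (n : ℕ)
  | lam (e : Expr Actor Lock)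
  | pair (e e' : Expr Actor Lock)
  | fst (e : Expr Actor Lock)
  | snd (e : Expr Actor Lock)
  | inl (e : Expr Actor Lock)
  | inr (e : Expr Actor Lock)
  | caseOf (e e₁ e₂ : Expr Actor Lock)
  | app (e e' : Expr Actor Lock)
  | new (e : Expr Actor Lock) (τ : Ty Actor Lock)
  | deref (e : Expr Actor Lock)
  | assign (e e' : Expr Actor Lock)
  | openIn (σ : Lock) (e : Expr Actor Lock)
  | openedIn (σ : Lock) (e : Expr Actor Lock)
  | closeIn (σ : Lock) (e : Expr Actor Lock)
  | closedIn (σ : Lock) (e : Expr Actor Lock)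
  | whenOpen (σ : Lock) (e e' : Expr Actor Lock)
  | loc (l : Loc)

/-- Pass a renaming under a binder. -/
def liftRen (ξ : ℕ → ℕ) : ℕ → ℕ
  | 0 => 0
  | x + 1 => ξ x + 1

def Expr.rename {Actor : Type u} {Lock : Type v} :
    Expr Actor Lock → (ℕ → ℕ) → Expr Actor Lock
  | .var x, ξ => .var (ξ x)
  | .unit, _ => .unit
  | .nat n, _ => .nat n
  | .lam e, ξ => .lam (e.rename (liftRen ξ))
  | .pair e e', ξ => .pair (e.rename ξ) (e'.rename ξ)
  | .fst e, ξ => .fst (e.rename ξ)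
  | .snd e, ξ => .snd (e.rename ξ)
  | .inl e, ξ => .inl (e.rename ξ)
  | .inr e, ξ => .inr (e.rename ξ)
  | .caseOf e e₁ e₂, ξ =>
      .caseOf (e.rename ξ) (e₁.rename (liftRen ξ)) (e₂.rename (liftRen ξ))
  | .app e e', ξ => .app (e.rename ξ) (e'.rename ξ)
  | .new e τ, ξ => .new (e.rename ξ) τ
  | .deref e, ξ => .deref (e.rename ξ)
  | .assign e e', ξ => .assign (e.rename ξ) (e'.rename ξ)
  | .openIn σ e, ξ => .openIn σ (e.rename ξ)
  | .openedIn σ e, ξ => .openedIn σ (e.rename ξ)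
  | .closeIn σ e, ξ => .closeIn σ (e.rename ξ)
  | .closedIn σ e, ξ => .closedIn σ (e.rename ξ)
  | .whenOpen σ e e', ξ => .whenOpen σ (e.rename ξ) (e'.rename ξ)
  | .loc l, _ => .loc l

/-- Pass a substitution under a binder. -/
def liftSubst {Actor : Type u} {Lock : Type v} (γ : ℕ → Expr Actor Lock) :
    ℕ → Expr Actor Lock
  | 0 => .var 0
  | x + 1 => (γ x).rename Nat.succ

/-- Simultaneous capture-avoiding substitution. -/
def Expr.subst {Actor : Type u} {Lock : Type v} :
    Expr Actor Lock → (ℕ → Expr Actor Lock) → Expr Actor Lock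
  | .var x, γ => γ x
  | .unit, _ => .unit
  | .nat n, _ => .nat n
  | .lam e, γ => .lam (e.subst (liftSubst γ))
  | .pair e e', γ => .pair (e.subst γ) (e'.subst γ)
  | .fst e, γ => .fst (e.subst γ)
  | .snd e, γ => .snd (e.subst γ)
  | .inl e, γ => .inl (e.subst γ)
  | .inr e, γ => .inr (e.subst γ)
  | .caseOf e e₁ e₂, γ =>
      .caseOf (e.subst γ) (e₁.subst (liftSubst γ)) (e₂.subst (liftSubst γ))
  | .app e e', γ => .app (e.subst γ) (e'.subst γ)
  | .new e τ, γ => .new (e.subst γ) τ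
  | .deref e, γ => .deref (e.subst γ)
  | .assign e e', γ => .assign (e.subst γ) (e'.subst γ)
  | .openIn σ e, γ => .openIn σ (e.subst γ)
  | .openedIn σ e, γ => .openedIn σ (e.subst γ)
  | .closeIn σ e, γ => .closeIn σ (e.subst γ)
  | .closedIn σ e, γ => .closedIn σ (e.subst γ)
  | .whenOpen σ e e', γ => .whenOpen σ (e.subst γ) (e'.subst γ)
  | .loc l, _ => .loc l

/-- The substitution of `v` for index `0`; the other indices move down by one. -/
def single {Actor : Type u} {Lock : Type v} (v : Expr Actor Lock) : ℕ → Expr Actor Lock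
  | 0 => v
  | x + 1 => .var x

/-- `[v/x]e`, where `x` is the variable with index `0`. -/
def Expr.inst {Actor : Type u} {Lock : Type v} (e v : Expr Actor Lock) : Expr Actor Lock :=
  e.subst (single v)

inductive Expr.IsValue {Actor : Type u} {Lock : Type v} : Expr Actor Lock → Prop where
  | lam (e : Expr Actor Lock) : IsValue (.lam e)
  | pair {v v' : Expr Actor Lock} : IsValue v → IsValue v' → IsValue (.pair v v')
  | inl {v : Expr Actor Lock} : IsValue v → IsValue (.inl v)
  | inr {v : Expr Actor Lock} : IsValue v → IsValue (.inr v)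
  | unit : IsValue .unit
  | loc (l : Loc) : IsValue (.loc l)
  | nat (n : ℕ) : IsValue (.nat n)

abbrev Value (Actor : Type u) (Lock : Type v) := {e : Expr Actor Lock // e.IsValue}

/-! ### Operational semantics -/

/-- A heap state maps finitely many locations to a value and the type of the location. -/
structure State (Actor : Type u) (Lock : Type v) where
  lookup : Loc → Option (Value Actor Lock × Ty Actor Lock)
  finite_dom : {l | lookup l ≠ none}.Finite

/-- `S[l ↦ v, τ]`: allocate or overwrite location `l`. -/
def State.update {Actor : Type u} {Lock : Type v} (S : State Actor Lock) (l : Loc)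
    (v : Value Actor Lock) (τ : Ty Actor Lock) : State Actor Lock where
  lookup := Function.update S.lookup l (some (v, τ))
  finite_dom := by
    refine (S.finite_dom.insert l).subset fun k hk => ?_
    by_cases h : k = l
    · exact Or.inl h
    · right
      simpa [Function.update_of_ne h] using hk

/-- Observations; `eps` is the empty observation. -/
inductive Obs (Actor : Type u) (Lock : Type v) : Type (max u v) where
  | eps
  | write (l : Loc) (τ : Ty Actor Lock) (v : Value Actor Lock)
  | opn (σ : Lock)
  | unopen (σ : Lock)
  | cls (σ : Lock)
  | unclose (σ : Lock)

/-- The policy of an observation, where `L` gives the policies of the locks; it is undefined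
for the empty observation. -/
def Obs.policy {Actor : Type u} {Lock : Type v} (L : Lock → Policy Actor Lock) :
    Obs Actor Lock → Option (Policy Actor Lock)
  | .eps => none
  | .write _ τ _ => some τ.policy
  | .opn σ => some (L σ)
  | .unopen σ => some (L σ)
  | .cls σ => some (L σ)
  | .unclose σ => some (L σ)

/-- The observation has a policy, and this policy flows to the attacker. -/
def Obs.Visible {Actor : Type u} {Lock : Type v} (L : Lock → Policy Actor Lock)
    (A : Attacker Actor Lock) (ω : Obs Actor Lock) : Prop :=
  ∃ P, ω.policy L = some P ∧ P ⊑ A.policy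

/-- `Step e K S e' S' ω K'`: with open locks `K` and in state `S`, the expression `e` reduces
to `e'` with new state `S'` and observation `ω`; `K'` is the lock set active at the redex. -/
inductive Step {Actor : Type u} {Lock : Type v} :
    Expr Actor Lock → Set Lock → State Actor Lock →
    Expr Actor Lock → State Actor Lock → Obs Actor Lock → Set Lock → Prop where
  | openBeta {σ e K S} : Step (.openIn σ e) K S (.openedIn σ e) S (.opn σ) K
  | opened {σ e K S e' S' ω K'} :
      Step e (K ∪ {σ}) S e' S' ω K' →
      Step (.openedIn σ e) K S (.openedIn σ e') S' ω K'
  | openedBeta {σ K S} {v : Value Actor Lock} :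
      Step (.openedIn σ v.1) K S v.1 S (.unopen σ) K
  | closeBeta {σ e K S} : Step (.closeIn σ e) K S (.closedIn σ e) S (.cls σ) K
  | closed {σ e K S e' S' ω K'} :
      Step e (K \ {σ}) S e' S' ω K' →
      Step (.closedIn σ e) K S (.closedIn σ e') S' ω K'
  | closedBeta {σ K S} {v : Value Actor Lock} :
      Step (.closedIn σ v.1) K S v.1 S (.unclose σ) K
  | deref {e K S e' S' ω K'} :
      Step e K S e' S' ω K' → Step (.deref e) K S (.deref e') S' ω K'
  | derefBeta {l K S τ} {v : Value Actor Lock} :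
      S.lookup l = some (v, τ) → Step (.deref (.loc l)) K S v.1 S .eps K
  | new {e τ K S e' S' ω K'} :
      Step e K S e' S' ω K' → Step (.new e τ) K S (.new e' τ) S' ω K'
  | newBeta {l τ K S} {v : Value Actor Lock} :
      S.lookup l = none →
      Step (.new v.1 τ) K S (.loc l) (S.update l v τ) (.write l τ v) K
  | assignL {e₁ e₂ K S e₁' S' ω K'} :
      Step e₁ K S e₁' S' ω K' → Step (.assign e₁ e₂) K S (.assign e₁' e₂) S' ω K'
  | assignR {l e K S e' S' ω K'} :
      Step e K S e' S' ω K' → Step (.assign (.loc l) e) K S (.assign (.loc l) e') S' ω K'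
  | assignBeta {l τ K S} {v₀ v : Value Actor Lock} :
      S.lookup l = some (v₀, τ) →
      Step (.assign (.loc l) v.1) K S .unit (S.update l v τ) (.write l τ v) K
  | appL {e₁ e₂ K S e₁' S' ω K'} :
      Step e₁ K S e₁' S' ω K' → Step (.app e₁ e₂) K S (.app e₁' e₂) S' ω K'
  | appR {e e₂ K S e₂' S' ω K'} :
      Step e₂ K S e₂' S' ω K' → Step (.app (.lam e) e₂) K S (.app (.lam e) e₂') S' ω K'
  | appBeta {e K S} {v : Value Actor Lock} :
      Step (.app (.lam e) v.1) K S (e.inst v.1) S .eps K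
  | pairL {e₁ e₂ K S e₁' S' ω K'} :
      Step e₁ K S e₁' S' ω K' → Step (.pair e₁ e₂) K S (.pair e₁' e₂) S' ω K'
  | pairR {e K S e' S' ω K'} {v : Value Actor Lock} :
      Step e K S e' S' ω K' → Step (.pair v.1 e) K S (.pair v.1 e') S' ω K'
  | fst {e K S e' S' ω K'} :
      Step e K S e' S' ω K' → Step (.fst e) K S (.fst e') S' ω K'
  | fstBeta {K S} {v v' : Value Actor Lock} :
      Step (.fst (.pair v.1 v'.1)) K S v.1 S .eps K
  | snd {e K S e' S' ω K'} :
      Step e K S e' S' ω K' → Step (.snd e) K S (.snd e') S' ω K'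
  | sndBeta {K S} {v v' : Value Actor Lock} :
      Step (.snd (.pair v.1 v'.1)) K S v'.1 S .eps K
  | inl {e K S e' S' ω K'} :
      Step e K S e' S' ω K' → Step (.inl e) K S (.inl e') S' ω K'
  | inr {e K S e' S' ω K'} :
      Step e K S e' S' ω K' → Step (.inr e) K S (.inr e') S' ω K'
  | caseOf {e e₁ e₂ K S e' S' ω K'} :
      Step e K S e' S' ω K' → Step (.caseOf e e₁ e₂) K S (.caseOf e' e₁ e₂) S' ω K'
  | caseL {e₁ e₂ K S} {v : Value Actor Lock} :
      Step (.caseOf (.inl v.1) e₁ e₂) K S (e₁.inst v.1) S .eps K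
  | caseR {e₁ e₂ K S} {v : Value Actor Lock} :
      Step (.caseOf (.inr v.1) e₁ e₂) K S (e₂.inst v.1) S .eps K
  | whenOpen {σ e₁ e₂ K S e₁' S' ω K'} :
      σ ∈ K → Step e₁ K S e₁' S' ω K' →
      Step (.whenOpen σ e₁ e₂) K S (.whenOpen σ e₁' e₂) S' ω K'
  | whenClosed {σ e₁ e₂ K S e₂' S' ω K'} :
      σ ∉ K → Step e₂ K S e₂' S' ω K' →
      Step (.whenOpen σ e₁ e₂) K S (.whenOpen σ e₁ e₂') S' ω K'
  | whenOpenBeta {σ e₂ K S} {v : Value Actor Lock} :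
      σ ∈ K → Step (.whenOpen σ v.1 e₂) K S v.1 S .eps K
  | whenClosedBeta {σ e₁ K S} {v : Value Actor Lock} :
      σ ∉ K → Step (.whenOpen σ e₁ v.1) K S v.1 S .eps K

/-! ### Type system -/

mutual
/-- Subtyping of types. -/
inductive SubA {Actor : Type u} {Lock : Type v} : AType Actor Lock → AType Actor Lock → Prop where
  | unit : SubA .unit .unit
  | nat : SubA .nat .nat
  | ref {τ} : SubA (.ref τ) (.ref τ)
  | prod {τ₁ τ₂ τ₁' τ₂'} : Sub τ₁ τ₁' → Sub τ₂ τ₂' → SubA (.prod τ₁ τ₂) (.prod τ₁' τ₂')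
  | sum {τ₁ τ₂ τ₁' τ₂'} : Sub τ₁ τ₁' → Sub τ₂ τ₂' → SubA (.sum τ₁ τ₂) (.sum τ₁' τ₂')
  | arrow {K K' : Set Lock} {pc pc' : Policy Actor Lock} {τ₁ τ₂ τ₁' τ₂'} :
      Sub τ₁' τ₁ → Sub τ₂ τ₂' → pc' ⊑ pc → K ⊆ K' →
      SubA (.arrow K pc τ₁ τ₂) (.arrow K' pc' τ₁' τ₂')
/-- Subtyping of annotated types. -/
inductive Sub {Actor : Type u} {Lock : Type v} : Ty Actor Lock → Ty Actor Lock → Prop where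
  | ann {B B'} {P P' : Policy Actor Lock} : P ⊑ P' → SubA B B' → Sub (.ann B P) (.ann B' P')
end

/-- State environments: partial maps from locations to types. -/
abbrev Env (Actor : Type u) (Lock : Type v) := Loc → Option (Ty Actor Lock)

/-- `HasType L Γ K θ pc e τ` is the judgment `Γ; K; θ ⊢_pc e : τ`, where `L` gives the policies
of the locks. The entry of `Γ` at position `x` is the type of the variable with index `x`. -/
inductive HasType {Actor : Type u} {Lock : Type v} (L : Lock → Policy Actor Lock) :
    List (Ty Actor Lock) → Set Lock → Env Actor Lock → Policy Actor Lock →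
    Expr Actor Lock → Ty Actor Lock → Prop where
  | var {Γ K θ pc x τ} : Γ[x]? = some τ → HasType L Γ K θ pc (.var x) τ
  | unit {Γ K θ pc} : HasType L Γ K θ pc .unit (.ann .unit Policy.bot)
  | nat {Γ K θ pc n} : HasType L Γ K θ pc (.nat n) (.ann .nat Policy.bot)
  | lam {Γ K θ pc K' pc' e τ₁ τ₂} :
      HasType L (τ₁ :: Γ) K' θ pc' e τ₂ →
      HasType L Γ K θ pc (.lam e) (.ann (.arrow K' pc' τ₁ τ₂) Policy.bot)
  | openIn {Γ K θ pc σ e τ} :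
      HasType L Γ (K ∪ {σ}) θ pc e τ → pc ⊑ L σ → HasType L Γ K θ pc (.openIn σ e) τ
  | openedIn {Γ K θ pc σ e τ} :
      HasType L Γ (K ∪ {σ}) θ pc e τ → pc ⊑ L σ → HasType L Γ K θ pc (.openedIn σ e) τ
  | closeIn {Γ K θ pc σ e τ} :
      HasType L Γ (K \ {σ}) θ pc e τ → pc ⊑ L σ → HasType L Γ K θ pc (.closeIn σ e) τ
  | closedIn {Γ K θ pc σ e τ} :
      HasType L Γ (K \ {σ}) θ pc e τ → pc ⊑ L σ → HasType L Γ K θ pc (.closedIn σ e) τ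
  | pair {Γ K θ pc e₁ e₂ τ₁ τ₂} :
      HasType L Γ K θ pc e₁ τ₁ → HasType L Γ K θ pc e₂ τ₂ →
      HasType L Γ K θ pc (.pair e₁ e₂) (.ann (.prod τ₁ τ₂) Policy.bot)
  | fst {Γ K θ pc e τ₁ τ₂ P} :
      HasType L Γ K θ pc e (.ann (.prod τ₁ τ₂) P) → P ⊑ τ₁.policy →
      HasType L Γ K θ pc (.fst e) τ₁
  | snd {Γ K θ pc e τ₁ τ₂ P} :
      HasType L Γ K θ pc e (.ann (.prod τ₁ τ₂) P) → P ⊑ τ₂.policy →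
      HasType L Γ K θ pc (.snd e) τ₂
  | inl {Γ K θ pc e τ₁ τ₂} :
      HasType L Γ K θ pc e τ₁ →
      HasType L Γ K θ pc (.inl e) (.ann (.sum τ₁ τ₂) Policy.bot)
  | inr {Γ K θ pc e τ₁ τ₂} :
      HasType L Γ K θ pc e τ₂ →
      HasType L Γ K θ pc (.inr e) (.ann (.sum τ₁ τ₂) Policy.bot)
  | caseOf {Γ K θ pc e e₁ e₂ τ₁ τ₂ τ P} :
      HasType L Γ K θ pc e (.ann (.sum τ₁ τ₂) P) → P ⊑ τ.policy →
      HasType L (τ₁ :: Γ) K θ (pc.join P) e₁ τ →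
      HasType L (τ₂ :: Γ) K θ (pc.join P) e₂ τ →
      HasType L Γ K θ pc (.caseOf e e₁ e₂) τ
  | sub {Γ K θ pc pc' e τ τ'} :
      HasType L Γ K θ pc' e τ' → pc ⊑ pc' → Sub τ' τ → HasType L Γ K θ pc e τ
  | app {Γ K θ pc e₁ e₂ K' pc' τ₁ τ₂ τ₁' P} :
      HasType L Γ K θ pc e₁ (.ann (.arrow K' pc' τ₁ τ₂) P) →
      HasType L Γ K θ pc e₂ τ₁' →
      P ⊑ τ₂.policy → pc.join P ⊑ pc' → Sub τ₁' τ₁ → K' ⊆ K →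
      HasType L Γ K θ pc (.app e₁ e₂) τ₂
  | deref {Γ K θ pc e τ τ' P} :
      HasType L Γ K θ pc e (.ann (.ref τ) P) → P ⊑ τ'.policy → Sub τ τ' →
      HasType L Γ K θ pc (.deref e) τ'
  | new {Γ K θ pc e τ τ'} :
      HasType L Γ K θ pc e τ' → pc ⊑ τ.policy → Sub (τ'.specialize K) τ →
      HasType L Γ K θ pc (.new e τ) (.ann (.ref τ) Policy.bot)
  | loc {Γ K θ pc l τ} :
      θ l = some τ → HasType L Γ K θ pc (.loc l) (.ann (.ref τ) Policy.bot)
  | assign {Γ K θ pc e e' τ τ' P} :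
      HasType L Γ K θ pc e (.ann (.ref τ') P) → Sub (τ.specialize K) τ' →
      HasType L Γ K θ pc e' τ → pc.join P ⊑ τ'.policy →
      HasType L Γ K θ pc (.assign e e') (.ann .unit Policy.bot)
  | whenOpen {Γ K θ pc σ e₁ e₂ τ} :
      HasType L Γ (K ∪ {σ}) θ (pc.join (L σ)) e₁ τ →
      HasType L Γ K θ (pc.join (L σ)) e₂ τ → L σ ⊑ τ.policy →
      HasType L Γ K θ pc (.whenOpen σ e₁ e₂) τ

/-! ### The unary relation -/

/-- `θ'` extends `θ`. -/
def Env.Ext {Actor : Type u} {Lock : Type v} (θ θ' : Env Actor Lock) : Prop :=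
  ∀ l τ, θ l = some τ → θ' l = some τ

/-- Well-formedness of a state in a state environment, with the interpretation `V` of types
left open: every location of `θ` is allocated in `S` with the type that `θ` gives to it, and
holds a value in the interpretation of this type. -/
def StateWFWith {Actor : Type u} {Lock : Type v} (V : Ty Actor Lock → Expr Actor Lock → Prop)
    (S : State Actor Lock) (θ : Env Actor Lock) : Prop :=
  ∀ l τ, θ l = some τ → ∃ v : Value Actor Lock, S.lookup l = some (v, τ) ∧ V τ v.1

mutual
/-- The unary value relation at step index `m`. -/
def UValA {Actor : Type u} {Lock : Type v} (L : Lock → Policy Actor Lock)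
    (m : ℕ) (B : AType Actor Lock) (θ : Env Actor Lock) (v : Expr Actor Lock) : Prop :=
  match B with
  | .unit => v = .unit
  | .nat => ∃ n, v = .nat n
  | .prod τ₁ τ₂ => ∃ v₁ v₂, v = .pair v₁ v₂ ∧ UVal L m τ₁ θ v₁ ∧ UVal L m τ₂ θ v₂
  | .sum τ₁ τ₂ =>
      (∃ v₁, v = .inl v₁ ∧ UVal L m τ₁ θ v₁) ∨ (∃ v₂, v = .inr v₂ ∧ UVal L m τ₂ θ v₂)
  | .arrow _ pc τ₁ τ₂ =>
      ∃ e, v = .lam e ∧ ∀ θ' w m', θ.Ext θ' → m' < m → UVal L m' τ₁ θ' w →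
        UExp L m' τ₂ pc θ' (e.inst w)
  | .ref τ => ∃ l, v = .loc l ∧ θ l = some τ
  termination_by (m, sizeOf B, 0)
/-- The unary value relation at annotated types; it ignores the policy. -/
def UVal {Actor : Type u} {Lock : Type v} (L : Lock → Policy Actor Lock)
    (m : ℕ) (τ : Ty Actor Lock) (θ : Env Actor Lock) (v : Expr Actor Lock) : Prop :=
  match τ with
  | .ann B _ => UValA L m B θ v
  termination_by (m, sizeOf τ, 0)
/-- The unary expression relation at program counter `pc` and step index `m`. -/
def UExp {Actor : Type u} {Lock : Type v} (L : Lock → Policy Actor Lock)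
    (m : ℕ) (τ : Ty Actor Lock) (pc : Policy Actor Lock) (θ : Env Actor Lock)
    (e : Expr Actor Lock) : Prop :=
  (¬ e.IsValue ∧ ∀ S θ' m' e' S' ω K K', θ.Ext θ' → m' < m →
    StateWFWith (fun τ' w => UVal L m' τ' θ' w) S θ' →
    Step e K S e' S' ω K' →
    (ω = .eps ∨ ∃ P, ω.policy L = some P ∧ pc ⊑ P) ∧
    ∃ θ'', θ'.Ext θ'' ∧ StateWFWith (fun τ' w => UVal L m' τ' θ'' w) S' θ'' ∧
      UExp L m' τ pc θ'' e') ∨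
  UVal L m τ θ e
  termination_by (m, sizeOf τ, 1)
end

/-- `(S, m) ▷ θ`: the state `S` is well-formed in `θ` at step index `m`. -/
def StateWF {Actor : Type u} {Lock : Type v} (L : Lock → Policy Actor Lock) (m : ℕ)
    (S : State Actor Lock) (θ : Env Actor Lock) : Prop :=
  StateWFWith (fun τ w => UVal L m τ θ w) S θ

/-! ### The binary relation -/

/-- Worlds: two state environments and a partial bijection between locations. -/
@[ext] structure World (Actor : Type u) (Lock : Type v) where
  θ₁ : Env Actor Lock
  θ₂ : Env Actor Lock
  β : Set (Loc × Loc)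
  functional : ∀ l k k', (l, k) ∈ β → (l, k') ∈ β → k = k'
  injective : ∀ l l' k, (l, k) ∈ β → (l', k) ∈ β → l = l'

/-- `W'` is a future world of `W`. -/
def World.Ext {Actor : Type u} {Lock : Type v} (W W' : World Actor Lock) : Prop :=
  W.θ₁.Ext W'.θ₁ ∧ W.θ₂.Ext W'.θ₂ ∧ W.β ⊆ W'.β

/-- The world `(θ, θ, id)`. -/
def World.diag {Actor : Type u} {Lock : Type v} (θ : Env Actor Lock) : World Actor Lock where
  θ₁ := θ
  θ₂ := θ
  β := {p | p.1 = p.2 ∧ θ p.1 ≠ none}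
  functional := fun _ _ _ h h' => h.1.symm.trans h'.1
  injective := fun _ _ _ h h' => h.1.trans h'.1.symm

/-- State indistinguishability in the world `W` at step index `m`, where `V` is the binary
value relation at `W` and `m`. -/
def StateIndistWith {Actor : Type u} {Lock : Type v} (L : Lock → Policy Actor Lock) (m : ℕ)
    (V : Ty Actor Lock → Expr Actor Lock → Expr Actor Lock → Prop)
    (S₁ S₂ : State Actor Lock) (W : World Actor Lock) : Prop :=
  StateWF L m S₁ W.θ₁ ∧ StateWF L m S₂ W.θ₂ ∧
  (∀ p ∈ W.β, W.θ₁ p.1 ≠ none ∧ W.θ₂ p.2 ≠ none) ∧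
  ∀ l₁ l₂, (l₁, l₂) ∈ W.β → W.θ₁ l₁ = W.θ₂ l₂ ∧
    ∀ τ τ₁ τ₂ v₁ v₂, W.θ₁ l₁ = some τ →
      S₁.lookup l₁ = some (v₁, τ₁) → S₂.lookup l₂ = some (v₂, τ₂) → V τ v₁.1 v₂.1

/-- Observational indistinguishability in the world `W`, where `V` is the binary value relation
at `W`. -/
inductive ObsIndistWith {Actor : Type u} {Lock : Type v} (L : Lock → Policy Actor Lock)
    (A : Attacker Actor Lock) (W : World Actor Lock)
    (V : Ty Actor Lock → Expr Actor Lock → Expr Actor Lock → Prop) :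
    Obs Actor Lock → Obs Actor Lock → Prop where
  | high {ω ω'} : ¬ ω.Visible L A → ¬ ω'.Visible L A → ObsIndistWith L A W V ω ω'
  | refl {ω} : (∀ l τ v, ω ≠ .write l τ v) → ObsIndistWith L A W V ω ω
  | extend {l l' τ} {v v' : Value Actor Lock} : V τ v.1 v'.1 → (l, l') ∈ W.β →
      ObsIndistWith L A W V (.write l τ v) (.write l' τ v')

/-- Observational irrelevance: weaker than indistinguishability, since it ignores the locations
of writes and one invisible observation is enough. -/
inductive ObsIrrelWith {Actor : Type u} {Lock : Type v} (L : Lock → Policy Actor Lock)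
    (A : Attacker Actor Lock)
    (V : Ty Actor Lock → Expr Actor Lock → Expr Actor Lock → Prop) :
    Obs Actor Lock → Obs Actor Lock → Prop where
  | refl {ω} : (∀ l τ v, ω ≠ .write l τ v) → ObsIrrelWith L A V ω ω
  | high {ω ω'} : ¬ ω.Visible L A ∨ ¬ ω'.Visible L A → ObsIrrelWith L A V ω ω'
  | extend {l l' τ} {v v' : Value Actor Lock} : V τ v.1 v'.1 →
      ObsIrrelWith L A V (.write l τ v) (.write l' τ v')

/-- Parallel steps. Here `m` is the step index, `V W` the binary value relation at `W` and `m`,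
and `E W` the binary expression relation (at the type and lock sets in question) at `W` and `m`;
`K₁`, `K₂` are the lock sets in which the two expressions run. -/
def CPar {Actor : Type u} {Lock : Type v} (L : Lock → Policy Actor Lock)
    (A : Attacker Actor Lock) (m : ℕ)
    (V : World Actor Lock → Ty Actor Lock → Expr Actor Lock → Expr Actor Lock → Prop)
    (E : World Actor Lock → Expr Actor Lock → Expr Actor Lock → Prop)
    (K₁ K₂ : Set Lock) (W : World Actor Lock) (S₁ S₂ : State Actor Lock)
    (e₁ e₂ : Expr Actor Lock) : Prop :=
  ¬ e₁.IsValue ∧ ¬ e₂.IsValue ∧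
  ∀ e₁' S₁' K₁' ω₁ e₂' S₂' K₂' ω₂,
    Step e₁ K₁ S₁ e₁' S₁' ω₁ K₁' → Step e₂ K₂ S₂ e₂' S₂' ω₂ K₂' →
    (ObsIrrelWith L A (V W) ω₁ ω₂ ∨ K₁' ⊆ A.locks ∨ K₂' ⊆ A.locks) →
    ∃ W', W.Ext W' ∧ StateIndistWith L m (V W') S₁' S₂' W' ∧
      ObsIndistWith L A W' (V W') ω₁ ω₂ ∧ E W' e₁' e₂'

/-- Unmatched invisible steps of the left expression. -/
def CLeft {Actor : Type u} {Lock : Type v} (L : Lock → Policy Actor Lock)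
    (A : Attacker Actor Lock) (m : ℕ)
    (V : World Actor Lock → Ty Actor Lock → Expr Actor Lock → Expr Actor Lock → Prop)
    (E : World Actor Lock → Expr Actor Lock → Expr Actor Lock → Prop)
    (K₁ : Set Lock) (W : World Actor Lock) (S₁ S₂ : State Actor Lock)
    (e₁ e₂ : Expr Actor Lock) : Prop :=
  ¬ e₁.IsValue ∧
  ∀ e₁' S₁' K₁' ω, Step e₁ K₁ S₁ e₁' S₁' ω K₁' →
    ¬ ω.Visible L A ∧
    ∃ W', W.Ext W' ∧ StateIndistWith L m (V W') S₁' S₂ W' ∧ E W' e₁' e₂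

/-- Unmatched invisible steps of the right expression. -/
def CRight {Actor : Type u} {Lock : Type v} (L : Lock → Policy Actor Lock)
    (A : Attacker Actor Lock) (m : ℕ)
    (V : World Actor Lock → Ty Actor Lock → Expr Actor Lock → Expr Actor Lock → Prop)
    (E : World Actor Lock → Expr Actor Lock → Expr Actor Lock → Prop)
    (K₂ : Set Lock) (W : World Actor Lock) (S₁ S₂ : State Actor Lock)
    (e₁ e₂ : Expr Actor Lock) : Prop :=
  ¬ e₂.IsValue ∧
  ∀ e₂' S₂' K₂' ω, Step e₂ K₂ S₂ e₂' S₂' ω K₂' →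
    ¬ ω.Visible L A ∧
    ∃ W', W.Ext W' ∧ StateIndistWith L m (V W') S₁ S₂' W' ∧ E W' e₁ e₂'

mutual
/-- The binary value relation for the attacker `A` at step index `m`. -/
def BValA {Actor : Type u} {Lock : Type v} (L : Lock → Policy Actor Lock)
    (A : Attacker Actor Lock) (m : ℕ) (B : AType Actor Lock) (W : World Actor Lock)
    (v v' : Expr Actor Lock) : Prop :=
  match B with
  | .unit => v = .unit ∧ v' = .unit
  | .nat => ∃ n, v = .nat n ∧ v' = .nat n
  | .prod τ₁ τ₂ => ∃ v₁ v₂ v₁' v₂', v = .pair v₁ v₂ ∧ v' = .pair v₁' v₂' ∧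
      BVal L A m τ₁ W v₁ v₁' ∧ BVal L A m τ₂ W v₂ v₂'
  | .sum τ₁ τ₂ =>
      (∃ w w', v = .inl w ∧ v' = .inl w' ∧ BVal L A m τ₁ W w w') ∨
      (∃ w w', v = .inr w ∧ v' = .inr w' ∧ BVal L A m τ₂ W w w')
  | .ref τ => ∃ l l', v = .loc l ∧ v' = .loc l' ∧
      W.θ₁ l = some τ ∧ W.θ₂ l' = some τ ∧ (l, l') ∈ W.β
  | .arrow K pc τ₁ τ₂ => ∃ e e', v = .lam e ∧ v' = .lam e' ∧
      (∀ W' m' w w' K₁ K₂, W.Ext W' → m' < m → BVal L A m' τ₁ W' w w' →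
        K ⊆ K₁ → K ⊆ K₂ → LockEquiv L A K₁ K₂ →
        BExp L A m' τ₂ W' K₁ K₂ (e.inst w) (e'.inst w')) ∧
      UValA L m (.arrow K pc τ₁ τ₂) W.θ₁ v ∧ UValA L m (.arrow K pc τ₁ τ₂) W.θ₂ v'
  termination_by (m, sizeOf B, 0)
/-- The binary value relation at annotated types: values that the attacker cannot see only
have to lie in the unary relation. -/
def BVal {Actor : Type u} {Lock : Type v} (L : Lock → Policy Actor Lock)
    (A : Attacker Actor Lock) (m : ℕ) (τ : Ty Actor Lock) (W : World Actor Lock)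
    (v v' : Expr Actor Lock) : Prop :=
  match τ with
  | .ann B P =>
      (P ⊑ A.policy ∧ BValA L A m B W v v') ∨
      (¬ P ⊑ A.policy ∧ UValA L m B W.θ₁ v ∧ UValA L m B W.θ₂ v')
  termination_by (m, sizeOf τ, 0)
/-- The binary expression relation for the attacker `A` at step index `m`, with open locks `K`
for `e₁` and `K'` for `e₂`. -/
def BExp {Actor : Type u} {Lock : Type v} (L : Lock → Policy Actor Lock)
    (A : Attacker Actor Lock) (m : ℕ) (τ : Ty Actor Lock) (W : World Actor Lock)
    (K K' : Set Lock) (e₁ e₂ : Expr Actor Lock) : Prop :=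
  (LockEquiv L A K K' ∧
    ∀ K₁ K₂, K ⊆ K₁ → K' ⊆ K₂ → LockEquiv L A K₁ K₂ →
    ∀ W' m' S₁ S₂, m' < m → W.Ext W' →
      StateIndistWith L m' (fun τ' w w' => BVal L A m' τ' W' w w') S₁ S₂ W' →
      CPar L A m' (fun W₀ τ' w w' => BVal L A m' τ' W₀ w w')
        (fun W₀ d d' => BExp L A m' τ W₀ K K' d d') K₁ K₂ W' S₁ S₂ e₁ e₂ ∨
      CLeft L A m' (fun W₀ τ' w w' => BVal L A m' τ' W₀ w w')
        (fun W₀ d d' => BExp L A m' τ W₀ K K' d d') K₁ W' S₁ S₂ e₁ e₂ ∨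
      CRight L A m' (fun W₀ τ' w w' => BVal L A m' τ' W₀ w w')
        (fun W₀ d d' => BExp L A m' τ W₀ K K' d d') K₂ W' S₁ S₂ e₁ e₂) ∨
  BVal L A m τ W e₁ e₂
  termination_by (m, sizeOf τ, 1)
end

/-! ### Security -/

/-- The binary substitution `(γ₁, γ₂)` is suitable for the context `Γ`. The values of `γ₁` and
`γ₂` at indices outside `Γ` play no role for expressions with free variables in `Γ`. -/
def BCtx {Actor : Type u} {Lock : Type v} (L : Lock → Policy Actor Lock)
    (A : Attacker Actor Lock) (m : ℕ) (Γ : List (Ty Actor Lock)) (W : World Actor Lock)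
    (γ₁ γ₂ : ℕ → Expr Actor Lock) : Prop :=
  ∀ x τ, Γ[x]? = some τ → BVal L A m τ W (γ₁ x) (γ₂ x)

/-- The expression `e` (with free variables in `Γ` and locations in `θ`) is secure at type `τ`
with program counter `pc` under open locks `K`. -/
def Secure {Actor : Type u} {Lock : Type v} (L : Lock → Policy Actor Lock)
    (Γ : List (Ty Actor Lock)) (K : Set Lock) (θ : Env Actor Lock) (pc : Policy Actor Lock)
    (e : Expr Actor Lock) (τ : Ty Actor Lock) : Prop :=
  ∀ (A : Attacker Actor Lock) (m : ℕ) (W : World Actor Lock) (γ₁ γ₂ : ℕ → Expr Actor Lock),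
    (World.diag θ).Ext W → BCtx L A m Γ W γ₁ γ₂ →
    BExp L A m τ W K K (e.subst γ₁) (e.subst γ₂) ∧
    UExp L m τ pc W.θ₁ (e.subst γ₁) ∧ UExp L m τ pc W.θ₂ (e.subst γ₂)

end WHR

/-!
Security is proved by two inductions on the typing derivation: `HasType.uExp` places a well-typed
expression in the unary relation, and `HasType.bExp` relates its two instances.

Both inductions run a subexpression to a value in an evaluation context and then look only at
redexes on values; `UExp.bind` and `BExp.bind` justify this, by induction on the step index. Since
the context may change the set of open locks and the binary relation quantifies over all low
equivalent supersets of the lock sets, `BExp.bind` also gives subsumption and the growth of the lock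
sets that the interpretation of functions needs.

If control flow or a reference depends on something the attacker `A` cannot see, the two runs need
not have anything to do with each other. The typing rules then force the program counter of what is
run next to be invisible. By the unary theorem all its writes are invisible, and invisible writes
only change locations whose contents need not be related (`StateIndist.left_step`,
`StateIndist.right_step`). So the two runs can be executed one after the other, by unmatched steps
(`BExp.of_uExp`). The results do not matter either: their type is invisible, or it is `unit`.

If everything relevant is visible, the two runs step in parallel. The delicate redexes are
allocation and assignment, where a value of type `τ'` is stored at a type `τ` that is above `τ'`
only when the locks `K` are open. If `τ` is visible to `A`, the relation demands nothing unless the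
values are already related at `τ`, or the open locks are within the capability of `A`. In the second
case `A` sees `τ'` as well, so the values are related at `τ'` visibly, hence at `τ`
(`BVal.release`, `BVal.release_of_irrel`).
-/

namespace WHR

variable {Actor : Type u} {Lock : Type v}

/-! ### Policies and lock sets -/

theorem Policy.Le.refl (P : Policy Actor Lock) : P ⊑ P :=
  fun c hc => ⟨c, hc, rfl, subset_rfl⟩

theorem Policy.Le.trans {P Q R : Policy Actor Lock} (h : P ⊑ Q) (h' : Q ⊑ R) : P ⊑ R := by
  intro c hc
  obtain ⟨d, hd, hda, hdl⟩ := h' c hc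
  obtain ⟨b, hb, hba, hbl⟩ := h d hd
  exact ⟨b, hb, hba.trans hda, hbl.trans hdl⟩

theorem Policy.bot_le (P : Policy Actor Lock) : Policy.bot ⊑ P :=
  fun c _ => ⟨⟨∅, c.actor⟩, rfl, rfl, Set.empty_subset _⟩

theorem Policy.le_join_left (P Q : Policy Actor Lock) : P ⊑ P.join Q := by
  rintro c ⟨d₁, h₁, d₂, -, ha, -, hl⟩
  exact ⟨d₁, h₁, ha, hl ▸ Set.subset_union_left⟩

theorem Policy.le_join_right (P Q : Policy Actor Lock) : Q ⊑ P.join Q := by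
  rintro c ⟨d₁, -, d₂, h₂, -, ha, hl⟩
  exact ⟨d₂, h₂, ha, hl ▸ Set.subset_union_right⟩

/-- An attacker that can open all the locks of `K` gains nothing from `K` being open. -/
theorem Policy.le_attacker_of_specialize {P : Policy Actor Lock} {K : Set Lock}
    {A : Attacker Actor Lock} (hK : K ⊆ A.locks) (h : P.specialize K ⊑ A.policy) :
    P ⊑ A.policy := by
  rintro c rfl
  obtain ⟨d, ⟨b, hb, hba, hdl⟩, hda, hdA⟩ := h _ rfl
  refine ⟨b, hb, hba.trans hda, fun σ hσ => ?_⟩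
  by_cases hσK : σ ∈ K
  · exact hK hσK
  · exact hdA (hdl ▸ ⟨hσ, hσK⟩)

theorem LockEquiv.refl (L : Lock → Policy Actor Lock) (A : Attacker Actor Lock) (K : Set Lock) :
    LockEquiv L A K K := rfl

theorem LockEquiv.mem_iff {L : Lock → Policy Actor Lock} {A : Attacker Actor Lock}
    {K K' : Set Lock} (h : LockEquiv L A K K') {σ : Lock} (hσ : L σ ⊑ A.policy) :
    σ ∈ K ↔ σ ∈ K' := by
  have := Set.ext_iff.1 h σ
  simpa [hσ] using this

theorem LockEquiv.of_mem_iff {L : Lock → Policy Actor Lock} {A : Attacker Actor Lock}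
    {K K' : Set Lock} (h : ∀ σ, L σ ⊑ A.policy → (σ ∈ K ↔ σ ∈ K')) : LockEquiv L A K K' := by
  ext σ
  simp only [Set.mem_ofPred_eq, and_congr_left_iff]
  exact h σ

theorem LockEquiv.insert {L : Lock → Policy Actor Lock} {A : Attacker Actor Lock}
    {K K' : Set Lock} (h : LockEquiv L A K K') (σ : Lock) :
    LockEquiv L A (K ∪ {σ}) (K' ∪ {σ}) :=
  .of_mem_iff fun _ hρ => or_congr (h.mem_iff hρ) Iff.rfl

theorem LockEquiv.erase {L : Lock → Policy Actor Lock} {A : Attacker Actor Lock}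
    {K K' : Set Lock} (h : LockEquiv L A K K') (σ : Lock) :
    LockEquiv L A (K \ {σ}) (K' \ {σ}) :=
  .of_mem_iff fun _ hρ => and_congr (h.mem_iff hρ) Iff.rfl

/-! ### Substitution -/

theorem liftRen_comp (ξ ξ' : ℕ → ℕ) : liftRen ξ' ∘ liftRen ξ = liftRen (ξ' ∘ ξ) := by
  funext x; cases x <;> rfl

theorem Expr.rename_rename (e : Expr Actor Lock) (ξ ξ' : ℕ → ℕ) :
    (e.rename ξ).rename ξ' = e.rename (ξ' ∘ ξ) := by
  induction e generalizing ξ ξ' <;> simp_all [Expr.rename, liftRen_comp]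

theorem liftSubst_comp_liftRen (γ : ℕ → Expr Actor Lock) (ξ : ℕ → ℕ) :
    liftSubst γ ∘ liftRen ξ = liftSubst (γ ∘ ξ) := by
  funext x; cases x <;> rfl

theorem Expr.subst_rename (e : Expr Actor Lock) (ξ : ℕ → ℕ) (γ : ℕ → Expr Actor Lock) :
    (e.rename ξ).subst γ = e.subst (γ ∘ ξ) := by
  induction e generalizing ξ γ <;> simp_all [Expr.rename, Expr.subst, liftSubst_comp_liftRen]

theorem rename_liftSubst (γ : ℕ → Expr Actor Lock) (ξ : ℕ → ℕ) :
    (fun x => (liftSubst γ x).rename (liftRen ξ)) = liftSubst fun x => (γ x).rename ξ := by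
  funext x
  cases x with
  | zero => rfl
  | succ x =>
    simp only [liftSubst, Expr.rename_rename]
    rfl

theorem Expr.rename_subst (e : Expr Actor Lock) (γ : ℕ → Expr Actor Lock) (ξ : ℕ → ℕ) :
    (e.subst γ).rename ξ = e.subst fun x => (γ x).rename ξ := by
  induction e generalizing γ ξ <;> simp_all [Expr.rename, Expr.subst, rename_liftSubst]

theorem subst_liftSubst (γ δ : ℕ → Expr Actor Lock) :
    (fun x => (liftSubst γ x).subst (liftSubst δ)) = liftSubst fun x => (γ x).subst δ := by
  funext x
  cases x with
  | zero => rfl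
  | succ x =>
    simp only [liftSubst, Expr.subst_rename, Expr.rename_subst]
    rfl

theorem Expr.subst_subst (e : Expr Actor Lock) (γ δ : ℕ → Expr Actor Lock) :
    (e.subst γ).subst δ = e.subst fun x => (γ x).subst δ := by
  induction e generalizing γ δ <;> simp_all [Expr.subst, subst_liftSubst]

theorem liftSubst_var : liftSubst (Expr.var : ℕ → Expr Actor Lock) = Expr.var := by
  funext x; cases x <;> rfl

theorem Expr.subst_var (e : Expr Actor Lock) : e.subst .var = e := by
  induction e <;> simp_all [Expr.subst, liftSubst_var]

/-- The substitution that maps index `0` to `w` and the index `x + 1` to `γ x`. -/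
def consSubst (w : Expr Actor Lock) (γ : ℕ → Expr Actor Lock) : ℕ → Expr Actor Lock
  | 0 => w
  | x + 1 => γ x

theorem Expr.inst_subst_liftSubst (e w : Expr Actor Lock) (γ : ℕ → Expr Actor Lock) :
    (e.subst (liftSubst γ)).inst w = e.subst (consSubst w γ) := by
  rw [Expr.inst, Expr.subst_subst]
  congr 1
  funext x
  cases x with
  | zero => rfl
  | succ x =>
    simp only [liftSubst, Expr.subst_rename]
    exact Expr.subst_var _

/-! ### Steps, redexes and evaluation contexts -/

theorem Expr.IsValue.not_step {v : Expr Actor Lock} (hv : v.IsValue) :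
    ∀ {K S e' S' ω K'}, ¬ Step v K S e' S' ω K' := by
  induction hv with
  | pair _ _ ih ih' =>
    intro K S e' S' ω K' h
    cases h with
    | pairL h => exact ih h
    | pairR h => exact ih' h
  | inl _ ih => intro K S e' S' ω K' h; cases h with | inl h => exact ih h
  | inr _ ih => intro K S e' S' ω K' h; cases h with | inr h => exact ih h
  | _ => intro K S e' S' ω K' h; cases h

/-- The only steps that change the state are the observable writes. -/
theorem Step.state_eq_or_write {e e' : Expr Actor Lock} {K K' S S' ω}
    (h : Step e K S e' S' ω K') :
    S' = S ∨ ∃ l τ v, ω = .write l τ v ∧ S' = S.update l v τ := by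
  induction h with
  | newBeta _ => exact .inr ⟨_, _, _, rfl, rfl⟩
  | assignBeta _ => exact .inr ⟨_, _, _, rfl, rfl⟩
  | _ => first | assumption | exact .inl rfl

/-- A redex whose only step leads to `d` with observation `ω`, whatever the state and the open
locks are, and leaves the state unchanged. -/
structure IsPureRedex (e d : Expr Actor Lock) (ω : Obs Actor Lock) : Prop where
  not_value : ¬ e.IsValue
  not_write : ∀ l τ v, ω ≠ .write l τ v
  step : ∀ {K S e' S' ω' K'}, Step e K S e' S' ω' K' → e' = d ∧ S' = S ∧ ω' = ω

theorem IsPureRedex.fst {v v' : Expr Actor Lock} (hv : v.IsValue) (hv' : v'.IsValue) :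
    IsPureRedex (.fst (.pair v v')) v .eps where
  not_value h := by cases h
  not_write := by simp
  step h := by
    cases h with
    | fst h => exact absurd h (hv.pair hv').not_step
    | fstBeta => simp

theorem IsPureRedex.snd {v v' : Expr Actor Lock} (hv : v.IsValue) (hv' : v'.IsValue) :
    IsPureRedex (.snd (.pair v v')) v' .eps where
  not_value h := by cases h
  not_write := by simp
  step h := by
    cases h with
    | snd h => exact absurd h (hv.pair hv').not_step
    | sndBeta => simp

theorem IsPureRedex.caseL {v : Expr Actor Lock} (hv : v.IsValue) (e₁ e₂ : Expr Actor Lock) :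
    IsPureRedex (.caseOf (.inl v) e₁ e₂) (e₁.inst v) .eps where
  not_value h := by cases h
  not_write := by simp
  step h := by
    cases h with
    | caseOf h => exact absurd h hv.inl.not_step
    | caseL => simp

theorem IsPureRedex.caseR {v : Expr Actor Lock} (hv : v.IsValue) (e₁ e₂ : Expr Actor Lock) :
    IsPureRedex (.caseOf (.inr v) e₁ e₂) (e₂.inst v) .eps where
  not_value h := by cases h
  not_write := by simp
  step h := by
    cases h with
    | caseOf h => exact absurd h hv.inr.not_step
    | caseR => simp

theorem IsPureRedex.app (e : Expr Actor Lock) {v : Expr Actor Lock} (hv : v.IsValue) :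
    IsPureRedex (.app (.lam e) v) (e.inst v) .eps where
  not_value h := by cases h
  not_write := by simp
  step h := by
    cases h with
    | appL h => exact absurd h (Expr.IsValue.lam e).not_step
    | appR h => exact absurd h hv.not_step
    | appBeta => simp

theorem IsPureRedex.openIn (σ : Lock) (e : Expr Actor Lock) :
    IsPureRedex (.openIn σ e) (.openedIn σ e) (.opn σ) where
  not_value h := by cases h
  not_write := by simp
  step h := by cases h; simp

theorem IsPureRedex.closeIn (σ : Lock) (e : Expr Actor Lock) :
    IsPureRedex (.closeIn σ e) (.closedIn σ e) (.cls σ) where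
  not_value h := by cases h
  not_write := by simp
  step h := by cases h; simp

theorem IsPureRedex.openedIn (σ : Lock) {v : Expr Actor Lock} (hv : v.IsValue) :
    IsPureRedex (.openedIn σ v) v (.unopen σ) where
  not_value h := by cases h
  not_write := by simp
  step h := by
    cases h with
    | opened h => exact absurd h hv.not_step
    | openedBeta => simp

theorem IsPureRedex.closedIn (σ : Lock) {v : Expr Actor Lock} (hv : v.IsValue) :
    IsPureRedex (.closedIn σ v) v (.unclose σ) where
  not_value h := by cases h
  not_write := by simp
  step h := by
    cases h with
    | closed h => exact absurd h hv.not_step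
    | closedBeta => simp

theorem Step.new_inv {v e' : Expr Actor Lock} {τ K K' S S' ω} (hv : v.IsValue)
    (h : Step (.new v τ) K S e' S' ω K') : ∃ l, S.lookup l = none ∧ e' = .loc l ∧
      S' = S.update l ⟨v, hv⟩ τ ∧ ω = .write l τ ⟨v, hv⟩ ∧ K' = K := by
  cases h with
  | new h => exact absurd h hv.not_step
  | newBeta hl => exact ⟨_, hl, rfl, rfl, rfl, rfl⟩

theorem Step.assign_inv {v e' : Expr Actor Lock} {l K K' S S' ω} (hv : v.IsValue)
    (h : Step (.assign (.loc l) v) K S e' S' ω K') : ∃ v₀ τ, S.lookup l = some (v₀, τ) ∧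
      e' = .unit ∧ S' = S.update l ⟨v, hv⟩ τ ∧ ω = .write l τ ⟨v, hv⟩ ∧ K' = K := by
  cases h with
  | assignL h => exact absurd h (Expr.IsValue.loc l).not_step
  | assignR h => exact absurd h hv.not_step
  | assignBeta hl => exact ⟨_, _, hl, rfl, rfl, rfl, rfl⟩

theorem Step.deref_inv {e' : Expr Actor Lock} {l K K' S S' ω}
    (h : Step (.deref (.loc l)) K S e' S' ω K') : ∃ v τ, S.lookup l = some (v, τ) ∧
      e' = v.1 ∧ S' = S ∧ ω = .eps := by
  cases h with
  | deref h => exact absurd h (Expr.IsValue.loc l).not_step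
  | derefBeta hl => exact ⟨_, _, hl, rfl, rfl, rfl⟩

theorem Step.whenOpen_inv_mem {e₁ e₂ d : Expr Actor Lock} {σ : Lock} {K K' S S' ω} (hσ : σ ∈ K)
    (h : Step (.whenOpen σ e₁ e₂) K S d S' ω K') :
    (∃ e₁', d = .whenOpen σ e₁' e₂ ∧ Step e₁ K S e₁' S' ω K') ∨
      (e₁.IsValue ∧ d = e₁ ∧ S' = S ∧ ω = .eps) := by
  cases h with
  | whenOpen _ h => exact .inl ⟨_, rfl, h⟩
  | whenClosed hσ' => exact absurd hσ hσ'
  | @whenOpenBeta _ _ _ _ v => exact .inr ⟨v.2, rfl, rfl, rfl⟩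
  | whenClosedBeta hσ' => exact absurd hσ hσ'

theorem Step.whenOpen_inv_not_mem {e₁ e₂ d : Expr Actor Lock} {σ : Lock} {K K' S S' ω}
    (hσ : σ ∉ K) (h : Step (.whenOpen σ e₁ e₂) K S d S' ω K') :
    (∃ e₂', d = .whenOpen σ e₁ e₂' ∧ Step e₂ K S e₂' S' ω K') ∨
      (e₂.IsValue ∧ d = e₂ ∧ S' = S ∧ ω = .eps) := by
  cases h with
  | whenOpen hσ' => exact absurd hσ' hσ
  | whenClosed _ h => exact .inl ⟨_, rfl, h⟩
  | whenOpenBeta hσ' => exact absurd hσ' hσ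
  | @whenClosedBeta _ _ _ _ v => exact .inr ⟨v.2, rfl, rfl, rfl⟩

/-- `C` is a single-hole evaluation context, presented as a function of the expression in the
hole; that expression runs with the locks `f K` open when the whole one runs with `K`. -/
structure IsEvalCtx (C : Expr Actor Lock → Expr Actor Lock) (f : Set Lock → Set Lock) : Prop where
  not_value : ∀ {e}, ¬ e.IsValue → ¬ (C e).IsValue
  step : ∀ {e K S d S' ω K'}, ¬ e.IsValue → Step (C e) K S d S' ω K' →
    ∃ e', d = C e' ∧ Step e (f K) S e' S' ω K'
  mono : Monotone f
  lockEquiv : ∀ {L : Lock → Policy Actor Lock} {A K K'}, LockEquiv L A K K' →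
    LockEquiv L A (f K) (f K')

theorem IsEvalCtx.hole : IsEvalCtx (Actor := Actor) (Lock := Lock) (fun e => e) id where
  not_value := id
  step _ h := ⟨_, rfl, h⟩
  mono := monotone_id
  lockEquiv := id

theorem IsEvalCtx.pairL (e' : Expr Actor Lock) : IsEvalCtx (fun e => .pair e e') id where
  not_value he h := by cases h; contradiction
  step he h := by
    cases h with
    | pairL h => exact ⟨_, rfl, h⟩
    | @pairR _ _ _ _ _ _ _ v h => exact absurd v.2 he
  mono := monotone_id
  lockEquiv := id

theorem IsEvalCtx.pairR {v : Expr Actor Lock} (hv : v.IsValue) :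
    IsEvalCtx (fun e => .pair v e) id where
  not_value he h := by cases h; contradiction
  step he h := by
    cases h with
    | pairL h => exact absurd h hv.not_step
    | pairR h => exact ⟨_, rfl, h⟩
  mono := monotone_id
  lockEquiv := id

theorem IsEvalCtx.fst : IsEvalCtx (Actor := Actor) (Lock := Lock) .fst id where
  not_value he h := by cases h
  step he h := by
    cases h with
    | fst h => exact ⟨_, rfl, h⟩
    | @fstBeta _ _ v v' => exact absurd (v.2.pair v'.2) he
  mono := monotone_id
  lockEquiv := id

theorem IsEvalCtx.snd : IsEvalCtx (Actor := Actor) (Lock := Lock) .snd id where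
  not_value he h := by cases h
  step he h := by
    cases h with
    | snd h => exact ⟨_, rfl, h⟩
    | @sndBeta _ _ v v' => exact absurd (v.2.pair v'.2) he
  mono := monotone_id
  lockEquiv := id

theorem IsEvalCtx.inl : IsEvalCtx (Actor := Actor) (Lock := Lock) .inl id where
  not_value he h := by cases h; contradiction
  step he h := by cases h with | inl h => exact ⟨_, rfl, h⟩
  mono := monotone_id
  lockEquiv := id

theorem IsEvalCtx.inr : IsEvalCtx (Actor := Actor) (Lock := Lock) .inr id where
  not_value he h := by cases h; contradiction
  step he h := by cases h with | inr h => exact ⟨_, rfl, h⟩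
  mono := monotone_id
  lockEquiv := id

theorem IsEvalCtx.caseOf (e₁ e₂ : Expr Actor Lock) : IsEvalCtx (fun e => .caseOf e e₁ e₂) id where
  not_value he h := by cases h
  step he h := by
    cases h with
    | caseOf h => exact ⟨_, rfl, h⟩
    | @caseL _ _ _ _ v => exact absurd v.2.inl he
    | @caseR _ _ _ _ v => exact absurd v.2.inr he
  mono := monotone_id
  lockEquiv := id

theorem IsEvalCtx.appL (e' : Expr Actor Lock) : IsEvalCtx (fun e => .app e e') id where
  not_value he h := by cases h
  step he h := by
    cases h with
    | appL h => exact ⟨_, rfl, h⟩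
    | appR h => exact absurd (.lam _) he
    | appBeta => exact absurd (.lam _) he
  mono := monotone_id
  lockEquiv := id

theorem IsEvalCtx.appR (d : Expr Actor Lock) : IsEvalCtx (fun e => .app (.lam d) e) id where
  not_value he h := by cases h
  step he h := by
    cases h with
    | appL h => exact absurd h (Expr.IsValue.lam d).not_step
    | appR h => exact ⟨_, rfl, h⟩
    | @appBeta _ _ _ v => exact absurd v.2 he
  mono := monotone_id
  lockEquiv := id

theorem IsEvalCtx.deref : IsEvalCtx (Actor := Actor) (Lock := Lock) .deref id where
  not_value he h := by cases h
  step he h := by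
    cases h with
    | deref h => exact ⟨_, rfl, h⟩
    | derefBeta => exact absurd (.loc _) he
  mono := monotone_id
  lockEquiv := id

theorem IsEvalCtx.new (τ : Ty Actor Lock) : IsEvalCtx (fun e => .new e τ) id where
  not_value he h := by cases h
  step he h := by
    cases h with
    | new h => exact ⟨_, rfl, h⟩
    | @newBeta _ _ _ _ v => exact absurd v.2 he
  mono := monotone_id
  lockEquiv := id

theorem IsEvalCtx.assignL (e' : Expr Actor Lock) : IsEvalCtx (fun e => .assign e e') id where
  not_value he h := by cases h
  step he h := by
    cases h with
    | assignL h => exact ⟨_, rfl, h⟩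
    | assignR h => exact absurd (.loc _) he
    | assignBeta => exact absurd (.loc _) he
  mono := monotone_id
  lockEquiv := id

theorem IsEvalCtx.assignR (l : Loc) :
    IsEvalCtx (Actor := Actor) (Lock := Lock) (fun e => .assign (.loc l) e) id where
  not_value he h := by cases h
  step he h := by
    cases h with
    | assignL h => exact absurd h (Expr.IsValue.loc l).not_step
    | assignR h => exact ⟨_, rfl, h⟩
    | @assignBeta _ _ _ _ _ v => exact absurd v.2 he
  mono := monotone_id
  lockEquiv := id

theorem IsEvalCtx.openedIn (σ : Lock) :
    IsEvalCtx (Actor := Actor) (Expr.openedIn σ) (· ∪ {σ}) where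
  not_value he h := by cases h
  step he h := by
    cases h with
    | opened h => exact ⟨_, rfl, h⟩
    | @openedBeta _ _ _ v => exact absurd v.2 he
  mono _ _ h := Set.union_subset_union_left _ h
  lockEquiv h := h.insert σ

theorem IsEvalCtx.closedIn (σ : Lock) :
    IsEvalCtx (Actor := Actor) (Expr.closedIn σ) (· \ {σ}) where
  not_value he h := by cases h
  step he h := by
    cases h with
    | closed h => exact ⟨_, rfl, h⟩
    | @closedBeta _ _ _ v => exact absurd v.2 he
  mono _ _ h := Set.sdiff_subset_sdiff_left h
  lockEquiv h := h.erase σ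

/-! ### The unary relation -/

section Unary

variable {L : Lock → Policy Actor Lock} {m m' : ℕ} {θ θ' : Env Actor Lock}
  {pc pc' P : Policy Actor Lock} {τ τ' τ₁ τ₂ : Ty Actor Lock} {e e' v v' : Expr Actor Lock}

theorem Env.Ext.refl (θ : Env Actor Lock) : θ.Ext θ := fun _ _ h => h

theorem Env.Ext.trans {θ'' : Env Actor Lock} (h : θ.Ext θ') (h' : θ'.Ext θ'') : θ.Ext θ'' :=
  fun l τ hl => h' l τ (h l τ hl)

theorem Env.ext_update {l : Loc} (hl : θ l = none) (τ : Ty Actor Lock) :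
    θ.Ext (Function.update θ l (some τ)) := by
  intro k τ' hk
  rw [Function.update_of_ne, hk]
  rintro rfl
  simp [hl] at hk

theorem UVal_ann {B : AType Actor Lock} : UVal L m (.ann B P) θ v ↔ UValA L m B θ v := by
  rw [UVal]

theorem UValA_unit : UValA L m .unit θ v ↔ v = .unit := by
  rw [UValA]

theorem UValA_nat : UValA L m .nat θ v ↔ ∃ n, v = .nat n := by
  rw [UValA]

theorem UValA_prod : UValA L m (.prod τ₁ τ₂) θ v ↔
    ∃ v₁ v₂, v = .pair v₁ v₂ ∧ UVal L m τ₁ θ v₁ ∧ UVal L m τ₂ θ v₂ := by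
  rw [UValA]

theorem UValA_sum : UValA L m (.sum τ₁ τ₂) θ v ↔
    (∃ v₁, v = .inl v₁ ∧ UVal L m τ₁ θ v₁) ∨ ∃ v₂, v = .inr v₂ ∧ UVal L m τ₂ θ v₂ := by
  rw [UValA]

theorem UValA_ref : UValA L m (.ref τ) θ v ↔ ∃ l, v = .loc l ∧ θ l = some τ := by
  rw [UValA]

theorem UValA_arrow {K : Set Lock} : UValA L m (.arrow K pc τ₁ τ₂) θ v ↔
    ∃ e, v = .lam e ∧ ∀ θ' w m', θ.Ext θ' → m' < m → UVal L m' τ₁ θ' w →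
      UExp L m' τ₂ pc θ' (e.inst w) := by
  rw [UValA]

theorem UExp_iff : UExp L m τ pc θ e ↔
    (¬ e.IsValue ∧ ∀ S θ' m' e' S' ω K K', θ.Ext θ' → m' < m → StateWF L m' S θ' →
      Step e K S e' S' ω K' →
      (ω = .eps ∨ ∃ P, ω.policy L = some P ∧ pc ⊑ P) ∧
      ∃ θ'', θ'.Ext θ'' ∧ StateWF L m' S' θ'' ∧ UExp L m' τ pc θ'' e') ∨
    UVal L m τ θ e := by
  rw [UExp]
  rfl

theorem UVal.uExp (h : UVal L m τ θ e) : UExp L m τ pc θ e :=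
  UExp_iff.2 (.inr h)

mutual
theorem UValA.isValue : ∀ {B : AType Actor Lock} {v : Expr Actor Lock},
    UValA L m B θ v → v.IsValue
  | .unit, _, h => UValA_unit.1 h ▸ .unit
  | .nat, _, h => by
    obtain ⟨n, rfl⟩ := UValA_nat.1 h
    exact .nat n
  | .prod _ _, _, h => by
    obtain ⟨v₁, v₂, rfl, h₁, h₂⟩ := UValA_prod.1 h
    exact .pair h₁.isValue h₂.isValue
  | .sum _ _, _, h => by
    obtain ⟨w, rfl, hw⟩ | ⟨w, rfl, hw⟩ := UValA_sum.1 h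
    · exact .inl hw.isValue
    · exact .inr hw.isValue
  | .ref _, _, h => by
    obtain ⟨l, rfl, -⟩ := UValA_ref.1 h
    exact .loc l
  | .arrow _ _ _ _, _, h => by
    obtain ⟨e, rfl, -⟩ := UValA_arrow.1 h
    exact .lam e
theorem UVal.isValue : ∀ {τ : Ty Actor Lock} {v : Expr Actor Lock}, UVal L m τ θ v → v.IsValue
  | .ann _ _, _, h => (UVal_ann.1 h).isValue
end

theorem UExp.uVal (h : UExp L m τ pc θ v) (hv : v.IsValue) : UVal L m τ θ v :=
  (UExp_iff.1 h).resolve_left fun h => h.1 hv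

mutual
theorem UValA.mono (hm : m' ≤ m) (hθ : θ.Ext θ') : ∀ {B : AType Actor Lock} {v : Expr Actor Lock},
    UValA L m B θ v → UValA L m' B θ' v
  | .unit, _, h => UValA_unit.2 (UValA_unit.1 h)
  | .nat, _, h => UValA_nat.2 (UValA_nat.1 h)
  | .prod _ _, _, h => by
    obtain ⟨v₁, v₂, rfl, h₁, h₂⟩ := UValA_prod.1 h
    exact UValA_prod.2 ⟨v₁, v₂, rfl, h₁.mono hm hθ, h₂.mono hm hθ⟩
  | .sum _ _, _, h => by
    obtain ⟨w, rfl, hw⟩ | ⟨w, rfl, hw⟩ := UValA_sum.1 h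
    · exact UValA_sum.2 (.inl ⟨w, rfl, hw.mono hm hθ⟩)
    · exact UValA_sum.2 (.inr ⟨w, rfl, hw.mono hm hθ⟩)
  | .ref _, _, h => by
    obtain ⟨l, rfl, hl⟩ := UValA_ref.1 h
    exact UValA_ref.2 ⟨l, rfl, hθ _ _ hl⟩
  | .arrow _ _ _ _, _, h => by
    obtain ⟨e, rfl, he⟩ := UValA_arrow.1 h
    exact UValA_arrow.2 ⟨e, rfl, fun θ'' w k hθ' hk => he θ'' w k (hθ.trans hθ') (hk.trans_le hm)⟩
theorem UVal.mono (hm : m' ≤ m) (hθ : θ.Ext θ') : ∀ {τ : Ty Actor Lock} {v : Expr Actor Lock},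
    UVal L m τ θ v → UVal L m' τ θ' v
  | .ann _ _, _, h => UVal_ann.2 ((UVal_ann.1 h).mono hm hθ)
end

theorem UExp.mono (hm : m' ≤ m) (hθ : θ.Ext θ') (h : UExp L m τ pc θ e) :
    UExp L m' τ pc θ' e := by
  rw [UExp_iff] at h ⊢
  refine h.imp (fun h => ⟨h.1, ?_⟩) (UVal.mono hm hθ)
  exact fun S θ'' k e' S' ω K K' hθ' hk => h.2 S θ'' k e' S' ω K K' (hθ.trans hθ') (hk.trans_le hm)

theorem StateWF.lookup {S : State Actor Lock} (h : StateWF L m S θ) {l : Loc} (hl : θ l = some τ) :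
    ∃ v : Value Actor Lock, S.lookup l = some (v, τ) ∧ UVal L m τ θ v.1 :=
  h l τ hl

theorem StateWF.env_eq_none {S : State Actor Lock} (h : StateWF L m S θ) {l : Loc}
    (hl : S.lookup l = none) : θ l = none := by
  by_contra hne
  obtain ⟨τ, hτ⟩ := Option.ne_none_iff_exists'.1 hne
  obtain ⟨v, hv, -⟩ := h.lookup hτ
  simp [hl] at hv

theorem State.lookup_update_self (S : State Actor Lock) (l : Loc) (v : Value Actor Lock)
    (τ : Ty Actor Lock) : (S.update l v τ).lookup l = some (v, τ) :=
  Function.update_self ..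

theorem State.lookup_update_of_ne (S : State Actor Lock) {k l : Loc} (h : k ≠ l)
    (v : Value Actor Lock) (τ : Ty Actor Lock) : (S.update l v τ).lookup k = S.lookup k :=
  Function.update_of_ne h ..

/-- Covers both allocation and overwriting: `θ'` is `θ` except that it may have the new
location `l`. -/
theorem StateWF.update {S : State Actor Lock} (h : StateWF L m S θ) (hθ : θ.Ext θ') {l : Loc}
    {v : Value Actor Lock} (hl : θ' l = some τ) (hk : ∀ k ≠ l, θ' k = θ k)
    (hv : UVal L m τ θ' v.1) : StateWF L m (S.update l v τ) θ' := by
  intro k τ' hkτ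
  by_cases hkl : k = l
  · subst hkl
    obtain rfl : τ = τ' := Option.some_injective _ (hl.symm.trans hkτ)
    exact ⟨v, S.lookup_update_self .., hv⟩
  · obtain ⟨w, hw, hwV⟩ := h.lookup ((hk k hkl).symm.trans hkτ)
    exact ⟨w, (S.lookup_update_of_ne hkl ..).trans hw, hwV.mono le_rfl hθ⟩

theorem StateWF.update_new {S : State Actor Lock} (h : StateWF L m S θ) {l : Loc}
    (hl : S.lookup l = none) {v : Value Actor Lock} (hv : UVal L m τ θ v.1) :
    StateWF L m (S.update l v τ) (Function.update θ l (some τ)) :=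
  have hθ := Env.ext_update (h.env_eq_none hl) τ
  h.update hθ (Function.update_self ..) (fun _ hk => Function.update_of_ne hk ..)
    (hv.mono le_rfl hθ)

/-- An expression may be replaced by its possible values in an evaluation context: the expression
relation is closed under the bind operation. -/
theorem UExp.bind {C : Expr Actor Lock → Expr Actor Lock} {f : Set Lock → Set Lock}
    {d : Expr Actor Lock} (hC : IsEvalCtx C f) (hpc : pc' ⊑ pc) (h : UExp L m τ pc θ e)
    (hv : ∀ m' θ' v, m' ≤ m → θ.Ext θ' → UVal L m' τ θ' v → UExp L m' τ' pc' θ' (C v))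
    (hd : d = C e := by rfl) : UExp L m τ' pc' θ d := by
  subst hd
  induction m using Nat.strong_induction_on generalizing θ e with
  | _ m ih =>
    rcases UExp_iff.1 h with ⟨hne, hstep⟩ | h
    · refine UExp_iff.2 (.inl ⟨hC.not_value hne, ?_⟩)
      intro S θ' k d S' ω K K' hθ hk hS hs
      obtain ⟨e', rfl, hs'⟩ := hC.step hne hs
      obtain ⟨hω, θ'', hθ', hS', he'⟩ := hstep S θ' k e' S' ω (f K) K' hθ hk hS hs'
      refine ⟨hω.imp_right fun ⟨P, hP, hle⟩ => ⟨P, hP, hpc.trans hle⟩, θ'', hθ', hS', ?_⟩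
      exact ih k hk he' fun j θ₃ v hj hθ₃ =>
        hv j θ₃ v (hj.trans hk.le) ((hθ.trans hθ').trans hθ₃)
    · exact hv m θ e le_rfl (.refl θ) h

theorem UExp.weaken (hpc : pc' ⊑ pc)
    (hτ : ∀ {m θ v}, UVal L m τ θ v → UVal L m τ' θ v) (h : UExp L m τ pc θ e) :
    UExp L m τ' pc' θ e :=
  UExp.bind .hole hpc h fun _ _ _ _ _ hv => (hτ hv).uExp

theorem UExp.of_redex {d : Expr Actor Lock} {ω : Obs Actor Lock} (hr : IsPureRedex e d ω)
    (hω : ω = .eps ∨ ∃ P, ω.policy L = some P ∧ pc ⊑ P)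
    (h : ∀ m' θ', m' < m → θ.Ext θ' → UExp L m' τ pc θ' d) : UExp L m τ pc θ e := by
  refine UExp_iff.2 (.inl ⟨hr.not_value, ?_⟩)
  intro S θ' k d S' ω K K' hθ hk hS hs
  obtain ⟨rfl, rfl, rfl⟩ := hr.step hs
  exact ⟨hω, θ', .refl θ', hS, h k θ' hk hθ⟩

theorem Sub.uVal (h : Sub τ τ') : ∀ {m : ℕ} {θ : Env Actor Lock} {v : Expr Actor Lock},
    UVal L m τ θ v → UVal L m τ' θ v := by
  refine Sub.rec
    (motive_1 := fun B B' _ => ∀ {m θ v}, UValA L m B θ v → UValA L m B' θ v)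
    (motive_2 := fun τ τ' _ => ∀ {m θ v}, UVal L m τ θ v → UVal L m τ' θ v)
    ?unit ?nat ?ref ?prod ?sum ?arrow ?ann h
  case unit => exact id
  case nat => exact id
  case ref => exact id
  case prod =>
    intro _ _ _ _ _ _ ih₁ ih₂ m θ v hv
    obtain ⟨v₁, v₂, rfl, hv₁, hv₂⟩ := UValA_prod.1 hv
    exact UValA_prod.2 ⟨v₁, v₂, rfl, ih₁ hv₁, ih₂ hv₂⟩
  case sum =>
    intro _ _ _ _ _ _ ih₁ ih₂ m θ v hv
    obtain ⟨w, rfl, hw⟩ | ⟨w, rfl, hw⟩ := UValA_sum.1 hv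
    · exact UValA_sum.2 (.inl ⟨w, rfl, ih₁ hw⟩)
    · exact UValA_sum.2 (.inr ⟨w, rfl, ih₂ hw⟩)
  case arrow =>
    intro _ _ _ _ _ _ _ _ _ _ hpc _ ih₁ ih₂ m θ v hv
    obtain ⟨e, rfl, he⟩ := UValA_arrow.1 hv
    exact UValA_arrow.2 ⟨e, rfl, fun θ' w k hθ hk hw => (he θ' w k hθ hk (ih₁ hw)).weaken hpc ih₂⟩
  case ann =>
    intro _ _ _ _ _ _ ih m θ v hv
    exact UVal_ann.2 (ih (UVal_ann.1 hv))

theorem SubA.uValA {B B' : AType Actor Lock} (h : SubA B B') (hv : UValA L m B θ v) :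
    UValA L m B' θ v :=
  UVal_ann.1 ((Sub.ann (.refl Policy.bot) h).uVal (UVal_ann.2 hv))

theorem UVal_specialize {K : Set Lock} : UVal L m (τ.specialize K) θ v ↔ UVal L m τ θ v := by
  cases τ
  rw [Ty.specialize, UVal_ann, UVal_ann]

/-- The unary interpretation of a context. -/
def UCtx (L : Lock → Policy Actor Lock) (m : ℕ) (Γ : List (Ty Actor Lock)) (θ : Env Actor Lock)
    (γ : ℕ → Expr Actor Lock) : Prop :=
  ∀ x τ, Γ[x]? = some τ → UVal L m τ θ (γ x)

theorem UCtx.mono {Γ : List (Ty Actor Lock)} {γ : ℕ → Expr Actor Lock} (hm : m' ≤ m)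
    (hθ : θ.Ext θ') (h : UCtx L m Γ θ γ) : UCtx L m' Γ θ' γ :=
  fun x τ hx => (h x τ hx).mono hm hθ

theorem UCtx.cons {Γ : List (Ty Actor Lock)} {γ : ℕ → Expr Actor Lock} (h : UCtx L m Γ θ γ)
    (hv : UVal L m τ θ v) : UCtx L m (τ :: Γ) θ (consSubst v γ) := by
  rintro (_ | x) τ' hx
  · obtain rfl : τ = τ' := by simpa using hx
    exact hv
  · exact h x τ' (by simpa using hx)

theorem UExp.openedIn {σ : Lock} (hσ : pc ⊑ L σ) (h : UExp L m τ pc θ e) :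
    UExp L m τ pc θ (.openedIn σ e) :=
  h.bind (.openedIn σ) (.refl pc) fun _ _ _ _ _ hv =>
    .of_redex (.openedIn σ hv.isValue) (.inr ⟨_, rfl, hσ⟩) fun _ _ hm hθ => (hv.mono hm.le hθ).uExp

theorem UExp.closedIn {σ : Lock} (hσ : pc ⊑ L σ) (h : UExp L m τ pc θ e) :
    UExp L m τ pc θ (.closedIn σ e) :=
  h.bind (.closedIn σ) (.refl pc) fun _ _ _ _ _ hv =>
    .of_redex (.closedIn σ hv.isValue) (.inr ⟨_, rfl, hσ⟩) fun _ _ hm hθ => (hv.mono hm.le hθ).uExp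

theorem UExp.openIn {σ : Lock} (hσ : pc ⊑ L σ) (h : UExp L m τ pc θ e) :
    UExp L m τ pc θ (.openIn σ e) :=
  .of_redex (.openIn σ e) (.inr ⟨_, rfl, hσ⟩) fun _ _ hm hθ => (h.mono hm.le hθ).openedIn hσ

theorem UExp.closeIn {σ : Lock} (hσ : pc ⊑ L σ) (h : UExp L m τ pc θ e) :
    UExp L m τ pc θ (.closeIn σ e) :=
  .of_redex (.closeIn σ e) (.inr ⟨_, rfl, hσ⟩) fun _ _ hm hθ => (h.mono hm.le hθ).closedIn hσ

theorem UVal.app_lam {K : Set Lock} {d : Expr Actor Lock}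
    (hd : UVal L m (.ann (.arrow K pc τ₁ τ₂) P) θ (.lam d)) (hv : UVal L m τ₁ θ v) :
    UExp L m τ₂ pc θ (.app (.lam d) v) := by
  obtain ⟨_, ⟨⟩, hd⟩ := UValA_arrow.1 (UVal_ann.1 hd)
  exact .of_redex (.app d hv.isValue) (.inl rfl) fun m' θ' hm hθ =>
    hd θ' v m' hθ hm (hv.mono hm.le hθ)

/-- Reading has no observable effect, so any program counter is possible. -/
theorem UVal.deref (hv : UVal L m (.ann (.ref τ) P) θ v) : UExp L m τ pc θ (.deref v) := by
  obtain ⟨l, rfl, hl⟩ := UValA_ref.1 (UVal_ann.1 hv)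
  refine UExp_iff.2 (.inl ⟨nofun, ?_⟩)
  intro S θ' k d S' ω K K' hθ hk hS hs
  obtain ⟨w, _, hw, rfl, rfl, rfl⟩ := hs.deref_inv
  obtain ⟨w', hw', hwV⟩ := hS.lookup (hθ _ _ hl)
  cases hw.symm.trans hw'
  exact ⟨.inl rfl, θ', .refl θ', hS, hwV.uExp⟩

theorem UVal.new (hpc : pc ⊑ τ.policy) (hv : UVal L m τ θ v) :
    UExp L m (.ann (.ref τ) P) pc θ (.new v τ) := by
  refine UExp_iff.2 (.inl ⟨nofun, ?_⟩)
  intro S θ' k d S' ω K K' hθ hk hS hs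
  obtain ⟨l, hl, rfl, rfl, rfl, -⟩ := hs.new_inv hv.isValue
  refine ⟨.inr ⟨_, rfl, hpc⟩, _, Env.ext_update (hS.env_eq_none hl) τ,
    hS.update_new hl (hv.mono hk.le hθ), UVal.uExp ?_⟩
  exact UVal_ann.2 (UValA_ref.2 ⟨l, rfl, Function.update_self ..⟩)

theorem UVal.assign (hpc : pc ⊑ τ.policy) (hr : UVal L m (.ann (.ref τ) P) θ v)
    (hv' : UVal L m τ θ v') : UExp L m (.ann .unit Policy.bot) pc θ (.assign v v') := by
  obtain ⟨l, rfl, hl⟩ := UValA_ref.1 (UVal_ann.1 hr)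
  refine UExp_iff.2 (.inl ⟨nofun, ?_⟩)
  intro S θ' k d S' ω K K' hθ hk hS hs
  obtain ⟨w, _, hw, rfl, rfl, rfl, -⟩ := hs.assign_inv hv'.isValue
  obtain ⟨w', hw', -⟩ := hS.lookup (hθ _ _ hl)
  cases hw.symm.trans hw'
  exact ⟨.inr ⟨_, rfl, hpc⟩, θ', .refl θ',
    hS.update (.refl θ') (hθ _ _ hl) (fun _ _ => rfl) (hv'.mono hk.le hθ),
    (UVal_ann.2 (UValA_unit.2 rfl)).uExp⟩

theorem UExp.whenOpen {σ : Lock} {e₁ e₂ : Expr Actor Lock} (h₁ : UExp L m τ pc θ e₁)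
    (h₂ : UExp L m τ pc θ e₂) : UExp L m τ pc θ (.whenOpen σ e₁ e₂) := by
  induction m using Nat.strong_induction_on generalizing θ e₁ e₂ with
  | _ m ih =>
    refine UExp_iff.2 (.inl ⟨nofun, ?_⟩)
    intro S θ' k d S' ω K K' hθ hk hS hs
    cases hs with
    | whenOpen _ hs =>
      rcases UExp_iff.1 h₁ with ⟨-, h⟩ | h
      · obtain ⟨hω, θ'', hθ', hS', he'⟩ := h S θ' k _ S' ω K K' hθ hk hS hs
        exact ⟨hω, θ'', hθ', hS', ih k hk he' (h₂.mono hk.le (hθ.trans hθ'))⟩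
      · exact absurd hs h.isValue.not_step
    | whenClosed _ hs =>
      rcases UExp_iff.1 h₂ with ⟨-, h⟩ | h
      · obtain ⟨hω, θ'', hθ', hS', he'⟩ := h S θ' k _ S' ω K K' hθ hk hS hs
        exact ⟨hω, θ'', hθ', hS', ih k hk (h₁.mono hk.le (hθ.trans hθ')) he'⟩
      · exact absurd hs h.isValue.not_step
    | whenOpenBeta => exact ⟨.inl rfl, θ', .refl θ', hS, h₁.mono hk.le hθ⟩
    | whenClosedBeta => exact ⟨.inl rfl, θ', .refl θ', hS, h₂.mono hk.le hθ⟩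

/-- The case construct on an injection, with branches that are safe for all later arguments. -/
theorem UVal.caseOf {e₁ e₂ : Expr Actor Lock} (hv : UVal L m (.ann (.sum τ₁ τ₂) P) θ v)
    (h₁ : ∀ m' θ' w, m' ≤ m → θ.Ext θ' → UVal L m' τ₁ θ' w → UExp L m' τ pc θ' (e₁.inst w))
    (h₂ : ∀ m' θ' w, m' ≤ m → θ.Ext θ' → UVal L m' τ₂ θ' w → UExp L m' τ pc θ' (e₂.inst w)) :
    UExp L m τ pc θ (.caseOf v e₁ e₂) := by
  obtain ⟨w, rfl, hw⟩ | ⟨w, rfl, hw⟩ := UValA_sum.1 (UVal_ann.1 hv)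
  · exact .of_redex (.caseL hw.isValue e₁ e₂) (.inl rfl) fun m' θ' hm hθ =>
      h₁ m' θ' w hm.le hθ (hw.mono hm.le hθ)
  · exact .of_redex (.caseR hw.isValue e₁ e₂) (.inl rfl) fun m' θ' hm hθ =>
      h₂ m' θ' w hm.le hθ (hw.mono hm.le hθ)

/-- The unary half of security: a well-typed expression lies in the unary relation. -/
theorem HasType.uExp {Γ : List (Ty Actor Lock)} {K : Set Lock} {θ₀ : Env Actor Lock}
    (h : HasType L Γ K θ₀ pc e τ) : ∀ {m : ℕ} {θ : Env Actor Lock} {γ : ℕ → Expr Actor Lock},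
    θ₀.Ext θ → UCtx L m Γ θ γ → UExp L m τ pc θ (e.subst γ) := by
  induction h with
  | var hx => exact fun _ hγ => (hγ _ _ hx).uExp
  | unit => exact fun _ _ => (UVal_ann.2 (UValA_unit.2 rfl)).uExp
  | @nat _ _ _ _ n => exact fun _ _ => (UVal_ann.2 (UValA_nat.2 ⟨n, rfl⟩)).uExp
  | lam _ ih =>
    intro m θ γ hθ hγ
    refine (UVal_ann.2 (UValA_arrow.2 ⟨_, rfl, fun θ' w k hθ' hk hw => ?_⟩)).uExp
    rw [Expr.inst_subst_liftSubst]
    exact ih (hθ.trans hθ') ((hγ.mono hk.le hθ').cons hw)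
  | openIn _ hσ ih => exact fun hθ hγ => (ih hθ hγ).openIn hσ
  | openedIn _ hσ ih => exact fun hθ hγ => (ih hθ hγ).openedIn hσ
  | closeIn _ hσ ih => exact fun hθ hγ => (ih hθ hγ).closeIn hσ
  | closedIn _ hσ ih => exact fun hθ hγ => (ih hθ hγ).closedIn hσ
  | pair _ _ ih₁ ih₂ =>
    intro m θ γ hθ hγ
    refine (ih₁ hθ hγ).bind (.pairL _) (.refl _) fun m₁ θ₁ v₁ hm₁ hθ₁ hv₁ => ?_
    refine (ih₂ (hθ.trans hθ₁) (hγ.mono hm₁ hθ₁)).bind (.pairR hv₁.isValue) (.refl _)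
      fun m₂ θ₂ v₂ hm₂ hθ₂ hv₂ => ?_
    exact (UVal_ann.2 (UValA_prod.2 ⟨v₁, v₂, rfl, hv₁.mono hm₂ hθ₂, hv₂⟩)).uExp
  | fst _ _ ih =>
    refine fun hθ hγ => (ih hθ hγ).bind .fst (.refl _) fun m₁ θ₁ v hm₁ hθ₁ hv => ?_
    obtain ⟨v₁, v₂, rfl, hv₁, hv₂⟩ := UValA_prod.1 (UVal_ann.1 hv)
    exact .of_redex (.fst hv₁.isValue hv₂.isValue) (.inl rfl) fun _ _ hm hθ =>
      (hv₁.mono hm.le hθ).uExp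
  | snd _ _ ih =>
    refine fun hθ hγ => (ih hθ hγ).bind .snd (.refl _) fun m₁ θ₁ v hm₁ hθ₁ hv => ?_
    obtain ⟨v₁, v₂, rfl, hv₁, hv₂⟩ := UValA_prod.1 (UVal_ann.1 hv)
    exact .of_redex (.snd hv₁.isValue hv₂.isValue) (.inl rfl) fun _ _ hm hθ =>
      (hv₂.mono hm.le hθ).uExp
  | inl _ ih =>
    exact fun hθ hγ => (ih hθ hγ).bind .inl (.refl _) fun _ _ v _ _ hv =>
      (UVal_ann.2 (UValA_sum.2 (.inl ⟨v, rfl, hv⟩))).uExp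
  | inr _ ih =>
    exact fun hθ hγ => (ih hθ hγ).bind .inr (.refl _) fun _ _ v _ _ hv =>
      (UVal_ann.2 (UValA_sum.2 (.inr ⟨v, rfl, hv⟩))).uExp
  | @caseOf _ _ _ _ _ _ _ _ _ _ P _ _ _ _ ih ih₁ ih₂ =>
    intro m θ γ hθ hγ
    refine (ih hθ hγ).bind (.caseOf _ _) (.refl _) fun m₁ θ₁ v hm₁ hθ₁ hv => ?_
    refine UExp.weaken (Policy.le_join_left _ P) id (hv.caseOf ?_ ?_)
    all_goals
      intro m₂ θ₂ w hm₂ hθ₂ hw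
      rw [Expr.inst_subst_liftSubst]
      have hγ' := (hγ.mono (hm₂.trans hm₁) (hθ₁.trans hθ₂)).cons hw
    · exact ih₁ (hθ.trans (hθ₁.trans hθ₂)) hγ'
    · exact ih₂ (hθ.trans (hθ₁.trans hθ₂)) hγ'
  | sub _ hpc hs ih =>
    exact fun hθ hγ => (ih hθ hγ).weaken hpc hs.uVal
  | app _ _ _ hpc hs _ ih₁ ih₂ =>
    intro m θ γ hθ hγ
    refine (ih₁ hθ hγ).bind (.appL _) (.refl _) fun m₁ θ₁ v hm₁ hθ₁ hv => ?_
    obtain ⟨d, rfl, -⟩ := UValA_arrow.1 (UVal_ann.1 hv)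
    refine (ih₂ (hθ.trans hθ₁) (hγ.mono hm₁ hθ₁)).bind (.appR d) (.refl _)
      fun m₂ θ₂ w hm₂ hθ₂ hw => ?_
    exact UExp.weaken ((Policy.le_join_left _ _).trans hpc) id
      ((hv.mono hm₂ hθ₂).app_lam (hs.uVal hw))
  | deref _ _ hs ih =>
    exact fun hθ hγ => (ih hθ hγ).bind .deref (.refl _) fun _ _ _ _ _ hv =>
      hv.deref.weaken (.refl _) hs.uVal
  | new _ hpc hs ih =>
    exact fun hθ hγ => (ih hθ hγ).bind (.new _) (.refl _) fun _ _ _ _ _ hv =>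
      (hs.uVal (UVal_specialize.2 hv)).new hpc
  | loc hl => exact fun hθ _ => (UVal_ann.2 (UValA_ref.2 ⟨_, rfl, hθ _ _ hl⟩)).uExp
  | assign _ hs _ hpc ih₁ ih₂ =>
    intro m θ γ hθ hγ
    refine (ih₁ hθ hγ).bind (.assignL _) (.refl _) fun m₁ θ₁ v hm₁ hθ₁ hv => ?_
    obtain ⟨l, rfl, -⟩ := UValA_ref.1 (UVal_ann.1 hv)
    exact (ih₂ (hθ.trans hθ₁) (hγ.mono hm₁ hθ₁)).bind (.assignR l) (.refl _)
      fun m₂ θ₂ w hm₂ hθ₂ hw => (hv.mono hm₂ hθ₂).assign ((Policy.le_join_left _ _).trans hpc)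
        (hs.uVal (UVal_specialize.2 hw))
  | whenOpen _ _ _ ih₁ ih₂ =>
    exact fun hθ hγ => ((ih₁ hθ hγ).whenOpen (ih₂ hθ hγ)).weaken
      (Policy.le_join_left _ _) id

end Unary

/-! ### The binary relation -/

theorem World.Ext.refl (W : World Actor Lock) : W.Ext W :=
  ⟨.refl _, .refl _, subset_rfl⟩

theorem World.Ext.trans {W W' W'' : World Actor Lock} (h : W.Ext W') (h' : W'.Ext W'') :
    W.Ext W'' :=
  ⟨h.1.trans h'.1, h.2.1.trans h'.2.1, h.2.2.trans h'.2.2⟩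

/-- The world `W` with its left state environment replaced by `θ`. -/
def World.withLeft (W : World Actor Lock) (θ : Env Actor Lock) : World Actor Lock :=
  { W with θ₁ := θ }

/-- The world `W` with its right state environment replaced by `θ`. -/
def World.withRight (W : World Actor Lock) (θ : Env Actor Lock) : World Actor Lock :=
  { W with θ₂ := θ }

/-- The world `W` with a new pair of corresponding locations `l`, `l'` of type `τ`. -/
def World.alloc (W : World Actor Lock) (l l' : Loc) (τ : Ty Actor Lock)
    (hl : ∀ k, (l, k) ∉ W.β) (hl' : ∀ k, (k, l') ∉ W.β) : World Actor Lock where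
  θ₁ := Function.update W.θ₁ l (some τ)
  θ₂ := Function.update W.θ₂ l' (some τ)
  β := insert (l, l') W.β
  functional := by
    rintro a b c (⟨⟨⟩⟩ | h) (⟨⟨⟩⟩ | h')
    · rfl
    · exact absurd h' (hl c)
    · exact absurd h (hl b)
    · exact W.functional a b c h h'
  injective := by
    rintro a b c (⟨⟨⟩⟩ | h) (⟨⟨⟩⟩ | h')
    · rfl
    · exact absurd h' (hl' b)
    · exact absurd h (hl' a)
    · exact W.injective a b c h h'

section Binary

variable {L : Lock → Policy Actor Lock} {A : Attacker Actor Lock} {m m' : ℕ}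
  {W W' : World Actor Lock} {pc P : Policy Actor Lock} {τ τ' τ₁ τ₂ : Ty Actor Lock}
  {K K' : Set Lock} {e₁ e₂ v v' : Expr Actor Lock}

theorem BVal_ann {B : AType Actor Lock} : BVal L A m (.ann B P) W v v' ↔
    (P ⊑ A.policy ∧ BValA L A m B W v v') ∨
      (¬ P ⊑ A.policy ∧ UValA L m B W.θ₁ v ∧ UValA L m B W.θ₂ v') := by
  rw [BVal]

theorem BValA_unit : BValA L A m .unit W v v' ↔ v = .unit ∧ v' = .unit := by
  rw [BValA]

theorem BValA_nat : BValA L A m .nat W v v' ↔ ∃ n, v = .nat n ∧ v' = .nat n := by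
  rw [BValA]

theorem BValA_prod : BValA L A m (.prod τ₁ τ₂) W v v' ↔
    ∃ v₁ v₂ v₁' v₂', v = .pair v₁ v₂ ∧ v' = .pair v₁' v₂' ∧
      BVal L A m τ₁ W v₁ v₁' ∧ BVal L A m τ₂ W v₂ v₂' := by
  rw [BValA]

theorem BValA_sum : BValA L A m (.sum τ₁ τ₂) W v v' ↔
    (∃ w w', v = .inl w ∧ v' = .inl w' ∧ BVal L A m τ₁ W w w') ∨
      ∃ w w', v = .inr w ∧ v' = .inr w' ∧ BVal L A m τ₂ W w w' := by
  rw [BValA]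

theorem BValA_ref : BValA L A m (.ref τ) W v v' ↔
    ∃ l l', v = .loc l ∧ v' = .loc l' ∧ W.θ₁ l = some τ ∧ W.θ₂ l' = some τ ∧ (l, l') ∈ W.β := by
  rw [BValA]

theorem BValA_arrow : BValA L A m (.arrow K pc τ₁ τ₂) W v v' ↔
    ∃ e e', v = .lam e ∧ v' = .lam e' ∧
      (∀ W' m' w w' K₁ K₂, W.Ext W' → m' < m → BVal L A m' τ₁ W' w w' →
        K ⊆ K₁ → K ⊆ K₂ → LockEquiv L A K₁ K₂ →
        BExp L A m' τ₂ W' K₁ K₂ (e.inst w) (e'.inst w')) ∧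
      UValA L m (.arrow K pc τ₁ τ₂) W.θ₁ v ∧ UValA L m (.arrow K pc τ₁ τ₂) W.θ₂ v' := by
  rw [BValA]

/-- State indistinguishability for the binary value relation. -/
def StateIndist (L : Lock → Policy Actor Lock) (A : Attacker Actor Lock) (m : ℕ)
    (S₁ S₂ : State Actor Lock) (W : World Actor Lock) : Prop :=
  StateIndistWith L m (fun τ w w' => BVal L A m τ W w w') S₁ S₂ W

theorem BExp_iff : BExp L A m τ W K K' e₁ e₂ ↔
    (LockEquiv L A K K' ∧
      ∀ K₁ K₂, K ⊆ K₁ → K' ⊆ K₂ → LockEquiv L A K₁ K₂ →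
      ∀ W' m' S₁ S₂, m' < m → W.Ext W' → StateIndist L A m' S₁ S₂ W' →
        CPar L A m' (fun W₀ τ' w w' => BVal L A m' τ' W₀ w w')
          (fun W₀ d d' => BExp L A m' τ W₀ K K' d d') K₁ K₂ W' S₁ S₂ e₁ e₂ ∨
        CLeft L A m' (fun W₀ τ' w w' => BVal L A m' τ' W₀ w w')
          (fun W₀ d d' => BExp L A m' τ W₀ K K' d d') K₁ W' S₁ S₂ e₁ e₂ ∨
        CRight L A m' (fun W₀ τ' w w' => BVal L A m' τ' W₀ w w')
          (fun W₀ d d' => BExp L A m' τ W₀ K K' d d') K₂ W' S₁ S₂ e₁ e₂) ∨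
    BVal L A m τ W e₁ e₂ := by
  rw [BExp]
  rfl

theorem BVal.bExp (h : BVal L A m τ W v v') : BExp L A m τ W K K' v v' :=
  BExp_iff.2 (.inr h)

mutual
theorem BValA.uValA : ∀ {B : AType Actor Lock} {v v' : Expr Actor Lock},
    BValA L A m B W v v' → UValA L m B W.θ₁ v ∧ UValA L m B W.θ₂ v'
  | .unit, _, _, h => (BValA_unit.1 h).imp UValA_unit.2 UValA_unit.2
  | .nat, _, _, h => by
    obtain ⟨n, hn⟩ := BValA_nat.1 h
    exact hn.imp (fun h => UValA_nat.2 ⟨n, h⟩) (fun h => UValA_nat.2 ⟨n, h⟩)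
  | .prod _ _, _, _, h => by
    obtain ⟨v₁, v₂, v₁', v₂', rfl, rfl, h₁, h₂⟩ := BValA_prod.1 h
    exact ⟨UValA_prod.2 ⟨v₁, v₂, rfl, h₁.uVal.1, h₂.uVal.1⟩,
      UValA_prod.2 ⟨v₁', v₂', rfl, h₁.uVal.2, h₂.uVal.2⟩⟩
  | .sum _ _, _, _, h => by
    obtain ⟨w, w', rfl, rfl, hw⟩ | ⟨w, w', rfl, rfl, hw⟩ := BValA_sum.1 h
    · exact ⟨UValA_sum.2 (.inl ⟨w, rfl, hw.uVal.1⟩), UValA_sum.2 (.inl ⟨w', rfl, hw.uVal.2⟩)⟩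
    · exact ⟨UValA_sum.2 (.inr ⟨w, rfl, hw.uVal.1⟩), UValA_sum.2 (.inr ⟨w', rfl, hw.uVal.2⟩)⟩
  | .ref _, _, _, h => by
    obtain ⟨l, l', rfl, rfl, hl, hl', -⟩ := BValA_ref.1 h
    exact ⟨UValA_ref.2 ⟨l, rfl, hl⟩, UValA_ref.2 ⟨l', rfl, hl'⟩⟩
  | .arrow _ _ _ _, _, _, h => by
    obtain ⟨_, _, _, _, -, hu⟩ := BValA_arrow.1 h
    exact hu
theorem BVal.uVal : ∀ {τ : Ty Actor Lock} {v v' : Expr Actor Lock},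
    BVal L A m τ W v v' → UVal L m τ W.θ₁ v ∧ UVal L m τ W.θ₂ v'
  | .ann _ _, _, _, h => by
    rw [UVal_ann, UVal_ann]
    exact (BVal_ann.1 h).elim (fun h => h.2.uValA) And.right
end

mutual
theorem BValA.mono (hm : m' ≤ m) (hW : W.Ext W') : ∀ {B : AType Actor Lock}
    {v v' : Expr Actor Lock}, BValA L A m B W v v' → BValA L A m' B W' v v'
  | .unit, _, _, h => BValA_unit.2 (BValA_unit.1 h)
  | .nat, _, _, h => BValA_nat.2 (BValA_nat.1 h)
  | .prod _ _, _, _, h => by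
    obtain ⟨v₁, v₂, v₁', v₂', rfl, rfl, h₁, h₂⟩ := BValA_prod.1 h
    exact BValA_prod.2 ⟨v₁, v₂, v₁', v₂', rfl, rfl, h₁.mono hm hW, h₂.mono hm hW⟩
  | .sum _ _, _, _, h => by
    obtain ⟨w, w', rfl, rfl, hw⟩ | ⟨w, w', rfl, rfl, hw⟩ := BValA_sum.1 h
    · exact BValA_sum.2 (.inl ⟨w, w', rfl, rfl, hw.mono hm hW⟩)
    · exact BValA_sum.2 (.inr ⟨w, w', rfl, rfl, hw.mono hm hW⟩)
  | .ref _, _, _, h => by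
    obtain ⟨l, l', rfl, rfl, hl, hl', hβ⟩ := BValA_ref.1 h
    exact BValA_ref.2 ⟨l, l', rfl, rfl, hW.1 _ _ hl, hW.2.1 _ _ hl', hW.2.2 hβ⟩
  | .arrow _ _ _ _, _, _, h => by
    obtain ⟨e, e', rfl, rfl, he, hu, hu'⟩ := BValA_arrow.1 h
    exact BValA_arrow.2 ⟨e, e', rfl, rfl,
      fun W'' k w w' K₁ K₂ hW' hk => he W'' k w w' K₁ K₂ (hW.trans hW') (hk.trans_le hm),
      hu.mono hm hW.1, hu'.mono hm hW.2.1⟩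
theorem BVal.mono (hm : m' ≤ m) (hW : W.Ext W') : ∀ {τ : Ty Actor Lock}
    {v v' : Expr Actor Lock}, BVal L A m τ W v v' → BVal L A m' τ W' v v'
  | .ann _ _, _, _, h => by
    rw [BVal_ann] at h ⊢
    exact h.imp (fun h => ⟨h.1, h.2.mono hm hW⟩)
      fun h => ⟨h.1, h.2.1.mono hm hW.1, h.2.2.mono hm hW.2.1⟩
end

theorem BExp.mono (hm : m' ≤ m) (hW : W.Ext W') (h : BExp L A m τ W K K' e₁ e₂) :
    BExp L A m' τ W' K K' e₁ e₂ := by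
  rw [BExp_iff] at h ⊢
  refine h.imp (fun h => ⟨h.1, ?_⟩) (BVal.mono hm hW)
  exact fun K₁ K₂ hK₁ hK₂ hKK W'' k S₁ S₂ hk hW' =>
    h.2 K₁ K₂ hK₁ hK₂ hKK W'' k S₁ S₂ (hk.trans_le hm) (hW.trans hW')

theorem BVal.of_invisible (hτ : ¬ τ.policy ⊑ A.policy) (h : UVal L m τ W.θ₁ v)
    (h' : UVal L m τ W.θ₂ v') : BVal L A m τ W v v' := by
  cases τ
  exact BVal_ann.2 (.inr ⟨hτ, UVal_ann.1 h, UVal_ann.1 h'⟩)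

theorem BVal.of_unit (h : UVal L m (.ann .unit P) W.θ₁ v) (h' : UVal L m (.ann .unit P) W.θ₂ v') :
    BVal L A m (.ann .unit P) W v v' := by
  rw [UVal_ann] at h h'
  rw [BVal_ann]
  by_cases hP : P ⊑ A.policy
  · exact .inl ⟨hP, BValA_unit.2 ⟨UValA_unit.1 h, UValA_unit.1 h'⟩⟩
  · exact .inr ⟨hP, h, h'⟩

theorem BVal_visible {B : AType Actor Lock} (hP : P ⊑ A.policy) :
    BVal L A m (.ann B P) W v v' ↔ BValA L A m B W v v' := by
  simp [BVal_ann, hP]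

theorem BVal_bot {B : AType Actor Lock} :
    BVal L A m (.ann B Policy.bot) W v v' ↔ BValA L A m B W v v' :=
  BVal_visible (Policy.bot_le _)

theorem StateIndist.update {S₁ S₂ : State Actor Lock} (h : StateIndist L A m S₁ S₂ W)
    (hW : W.Ext W') {l l' : Loc} {v v' : Value Actor Lock}
    (hβ : W'.β ⊆ insert (l, l') W.β) (hll : (l, l') ∈ W'.β)
    (hl : W'.θ₁ l = some τ) (hl' : W'.θ₂ l' = some τ)
    (hk : ∀ k ≠ l, W'.θ₁ k = W.θ₁ k) (hk' : ∀ k ≠ l', W'.θ₂ k = W.θ₂ k)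
    (hv : BVal L A m τ W' v.1 v'.1) :
    StateIndist L A m (S₁.update l v τ) (S₂.update l' v' τ) W' := by
  refine ⟨h.1.update hW.1 hl hk hv.uVal.1, h.2.1.update hW.2.1 hl' hk' hv.uVal.2, ?_, ?_⟩
  · rintro p hp
    obtain rfl | hp := hβ hp
    · simp [hl, hl']
    · obtain ⟨h₁, h₂⟩ := h.2.2.1 p hp
      obtain ⟨σ₁, hσ₁⟩ := Option.ne_none_iff_exists'.1 h₁
      obtain ⟨σ₂, hσ₂⟩ := Option.ne_none_iff_exists'.1 h₂
      simp [hW.1 _ _ hσ₁, hW.2.1 _ _ hσ₂]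
  · intro k k' hkk
    by_cases hkl : k = l
    · subst hkl
      obtain rfl := W'.functional _ _ _ hll hkk
      refine ⟨hl.trans hl'.symm, fun σ σ₁ σ₂ w w' hσ hw hw' => ?_⟩
      rw [State.lookup_update_self] at hw hw'
      cases hw
      cases hw'
      cases hl.symm.trans hσ
      exact hv
    · have hkl' : k' ≠ l' := fun h => hkl (W'.injective _ _ _ hkk (h ▸ hll))
      have hkk₀ : (k, k') ∈ W.β := (hβ hkk).resolve_left fun h => hkl (congrArg Prod.fst h)
      obtain ⟨heq, hval⟩ := h.2.2.2 k k' hkk₀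
      rw [hk k hkl, hk' k' hkl']
      refine ⟨heq, fun σ σ₁ σ₂ w w' hσ hw hw' => ?_⟩
      rw [State.lookup_update_of_ne _ hkl] at hw
      rw [State.lookup_update_of_ne _ hkl'] at hw'
      exact (hval σ σ₁ σ₂ w w' hσ hw hw').mono le_rfl hW

theorem StateIndist.lookup {S₁ S₂ : State Actor Lock} (h : StateIndist L A m S₁ S₂ W) {l l' : Loc}
    (hll : (l, l') ∈ W.β) (hl : W.θ₁ l = some τ) {σ₁ σ₂ : Ty Actor Lock} {v v' : Value Actor Lock}
    (hv : S₁.lookup l = some (v, σ₁)) (hv' : S₂.lookup l' = some (v', σ₂)) :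
    BVal L A m τ W v.1 v'.1 :=
  (h.2.2.2 l l' hll).2 τ σ₁ σ₂ v v' hl hv hv'

theorem Obs.Visible.of_write {l : Loc} {v : Value Actor Lock} (h : τ.policy ⊑ A.policy) :
    (Obs.write l τ v).Visible L A :=
  ⟨_, rfl, h⟩

/-- An observation bounded below by an invisible program counter is invisible. -/
theorem Obs.not_visible {ω : Obs Actor Lock} (hpc : ¬ pc ⊑ A.policy)
    (h : ω = .eps ∨ ∃ P, ω.policy L = some P ∧ pc ⊑ P) : ¬ ω.Visible L A := by
  rintro ⟨Q, hQ, hQA⟩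
  obtain rfl | ⟨P, hP, hle⟩ := h
  · cases hQ
  · cases hP.symm.trans hQ
    exact hpc (hle.trans hQA)

theorem World.ext_withLeft {θ : Env Actor Lock} (h : W.θ₁.Ext θ) : W.Ext (W.withLeft θ) :=
  ⟨h, .refl _, subset_rfl⟩

theorem World.ext_withRight {θ : Env Actor Lock} (h : W.θ₂.Ext θ) : W.Ext (W.withRight θ) :=
  ⟨.refl _, h, subset_rfl⟩

/-- Invisible steps on the left preserve state indistinguishability: what they write is related
because it only has to lie in the unary relation. -/
theorem StateIndist.left_step {S₁ S₂ S₁' : State Actor Lock} {θ : Env Actor Lock} {ω}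
    (h : StateIndist L A m S₁ S₂ W) (hs : Step e₁ K S₁ e₂ S₁' ω K') (hω : ¬ ω.Visible L A)
    (hθ : W.θ₁.Ext θ) (hS : StateWF L m S₁' θ) : StateIndist L A m S₁' S₂ (W.withLeft θ) := by
  have hW := World.ext_withLeft hθ
  refine ⟨hS, h.2.1, fun p hp => ⟨?_, (h.2.2.1 p hp).2⟩, fun k k' hkk => ?_⟩
  · obtain ⟨σ, hσ⟩ := Option.ne_none_iff_exists'.1 (h.2.2.1 p hp).1
    exact Option.ne_none_iff_exists'.2 ⟨σ, hθ _ _ hσ⟩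
  · obtain ⟨σ, hσ⟩ := Option.ne_none_iff_exists'.1 (h.2.2.1 _ hkk).1
    have hσ' : (W.withLeft θ).θ₁ k = some σ := hθ _ _ hσ
    have hσ₂ : W.θ₂ k' = some σ := (h.2.2.2 k k' hkk).1.symm.trans hσ
    refine ⟨hσ'.trans hσ₂.symm, fun ρ ρ₁ ρ₂ w w' hρ hw hw' => ?_⟩
    obtain rfl : σ = ρ := Option.some_injective _ (hσ'.symm.trans hρ)
    have hold (hw : S₁.lookup k = some (w, ρ₁)) : BVal L A m σ (W.withLeft θ) w.1 w'.1 :=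
      (h.lookup hkk hσ hw hw').mono le_rfl hW
    obtain rfl | ⟨l, ρ, u, rfl, rfl⟩ := hs.state_eq_or_write
    · exact hold hw
    · by_cases hkl : k = l
      · subst hkl
        obtain ⟨u₁, hu₁, hu₁V⟩ := hS.lookup hσ'
        obtain ⟨u₂, hu₂, hu₂V⟩ := h.2.1.lookup hσ₂
        cases hw.symm.trans hu₁
        cases hw'.symm.trans hu₂
        rw [State.lookup_update_self] at hw
        cases hw
        exact .of_invisible (fun hA => hω (.of_write hA)) hu₁V hu₂V
      · exact hold ((State.lookup_update_of_ne _ hkl ..).symm.trans hw)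

theorem StateIndist.right_step {S₁ S₂ S₂' : State Actor Lock} {θ : Env Actor Lock} {ω}
    (h : StateIndist L A m S₁ S₂ W) (hs : Step e₁ K S₂ e₂ S₂' ω K') (hω : ¬ ω.Visible L A)
    (hθ : W.θ₂.Ext θ) (hS : StateWF L m S₂' θ) : StateIndist L A m S₁ S₂' (W.withRight θ) := by
  have hW := World.ext_withRight hθ
  refine ⟨h.1, hS, fun p hp => ⟨(h.2.2.1 p hp).1, ?_⟩, fun k k' hkk => ?_⟩
  · obtain ⟨σ, hσ⟩ := Option.ne_none_iff_exists'.1 (h.2.2.1 p hp).2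
    exact Option.ne_none_iff_exists'.2 ⟨σ, hθ _ _ hσ⟩
  · obtain ⟨σ, hσ⟩ := Option.ne_none_iff_exists'.1 (h.2.2.1 _ hkk).1
    have hσ₂ : W.θ₂ k' = some σ := (h.2.2.2 k k' hkk).1.symm.trans hσ
    have hσ' : (W.withRight θ).θ₂ k' = some σ := hθ _ _ hσ₂
    refine ⟨hσ.trans hσ'.symm, fun ρ ρ₁ ρ₂ w w' hρ hw hw' => ?_⟩
    obtain rfl : σ = ρ := Option.some_injective _ (hσ.symm.trans hρ)
    have hold (hw' : S₂.lookup k' = some (w', ρ₂)) : BVal L A m σ (W.withRight θ) w.1 w'.1 :=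
      (h.lookup hkk hσ hw hw').mono le_rfl hW
    obtain rfl | ⟨l, ρ, u, rfl, rfl⟩ := hs.state_eq_or_write
    · exact hold hw'
    · by_cases hkl : k' = l
      · subst hkl
        obtain ⟨u₁, hu₁, hu₁V⟩ := h.1.lookup hσ
        obtain ⟨u₂, hu₂, hu₂V⟩ := hS.lookup hσ'
        cases hw.symm.trans hu₁
        cases hw'.symm.trans hu₂
        rw [State.lookup_update_self] at hw'
        cases hw'
        exact .of_invisible (fun hA => hω (.of_write hA)) hu₁V hu₂V
      · exact hold ((State.lookup_update_of_ne _ hkl ..).symm.trans hw')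

/-- Two expressions whose effects are invisible to the attacker are related, whatever they do,
if the attacker cannot tell their results apart. The left one runs to completion first, by
unmatched steps, and then the right one. -/
theorem BExp.of_uExp (hpc : ¬ pc ⊑ A.policy) (hK : LockEquiv L A K K')
    (hτ : ∀ {m W v v'}, UVal L m τ (World.θ₁ W) v → UVal L m τ (World.θ₂ W) v' →
      BVal L A m τ W v v')
    (h₁ : UExp L m τ pc W.θ₁ e₁) (h₂ : UExp L m τ pc W.θ₂ e₂) :
    BExp L A m τ W K K' e₁ e₂ := by
  induction m using Nat.strong_induction_on generalizing W e₁ e₂ with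
  | _ m ih =>
    rcases UExp_iff.1 h₁ with ⟨hn₁, hs₁⟩ | hv₁
    · refine BExp_iff.2 (.inl ⟨hK, fun K₁ K₂ _ _ _ W' k S₁ S₂ hk hW hS => .inr (.inl ⟨hn₁, ?_⟩)⟩)
      intro e₁' S₁' K₁' ω hs
      obtain ⟨hω, θ, hθ, hS', he'⟩ := hs₁ S₁ _ k e₁' S₁' ω K₁ K₁' hW.1 hk hS.1 hs
      have hω := Obs.not_visible hpc hω
      exact ⟨hω, W'.withLeft θ, World.ext_withLeft hθ, StateIndist.left_step hS hs hω hθ hS',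
        ih k hk he' (h₂.mono hk.le hW.2.1)⟩
    rcases UExp_iff.1 h₂ with ⟨hn₂, hs₂⟩ | hv₂
    · refine BExp_iff.2 (.inl ⟨hK, fun K₁ K₂ _ _ _ W' k S₁ S₂ hk hW hS => .inr (.inr ⟨hn₂, ?_⟩)⟩)
      intro e₂' S₂' K₂' ω hs
      obtain ⟨hω, θ, hθ, hS', he'⟩ := hs₂ S₂ _ k e₂' S₂' ω K₂ K₂' hW.2.1 hk hS.2.1 hs
      have hω := Obs.not_visible hpc hω
      exact ⟨hω, W'.withRight θ, World.ext_withRight hθ, StateIndist.right_step hS hs hω hθ hS',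
        ih k hk (h₁.mono hk.le hW.1) he'⟩
    · exact (hτ hv₁ hv₂).bExp

/-- The binary relation is closed under the bind operation. The lock sets `Ko` and `Ko'` of the
whole expressions may grow as long as they stay low equivalent. -/
theorem BExp.bind {C₁ C₂ : Expr Actor Lock → Expr Actor Lock} {f : Set Lock → Set Lock}
    {Ko Ko' : Set Lock} {d₁ d₂ : Expr Actor Lock} (hC₁ : IsEvalCtx C₁ f) (hC₂ : IsEvalCtx C₂ f)
    (hK : K ⊆ f Ko) (hK' : K' ⊆ f Ko') (hKo : LockEquiv L A Ko Ko')
    (h : BExp L A m τ W K K' e₁ e₂)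
    (hv : ∀ m' W' v v', m' ≤ m → W.Ext W' → BVal L A m' τ W' v v' →
      BExp L A m' τ' W' Ko Ko' (C₁ v) (C₂ v'))
    (hd₁ : d₁ = C₁ e₁ := by rfl) (hd₂ : d₂ = C₂ e₂ := by rfl) :
    BExp L A m τ' W Ko Ko' d₁ d₂ := by
  subst hd₁ hd₂
  induction m using Nat.strong_induction_on generalizing W e₁ e₂ with
  | _ m ih =>
    rcases BExp_iff.1 h with ⟨-, hstep⟩ | h
    swap
    · exact hv m W e₁ e₂ le_rfl (.refl W) h
    refine BExp_iff.2 (.inl ⟨hKo, fun K₁ K₂ hK₁ hK₂ hKK W' k S₁ S₂ hk hW hS => ?_⟩)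
    have next {W'' d₁ d₂} (hW' : W'.Ext W'') (hd : BExp L A k τ W'' K K' d₁ d₂) :
        BExp L A k τ' W'' Ko Ko' (C₁ d₁) (C₂ d₂) :=
      ih k hk hd fun j W₃ v v' hj hW₃ =>
        hv j W₃ v v' (hj.trans hk.le) ((hW.trans hW').trans hW₃)
    rcases hstep (f K₁) (f K₂) (hK.trans (hC₁.mono hK₁)) (hK'.trans (hC₁.mono hK₂))
      (hC₁.lockEquiv hKK) W' k S₁ S₂ hk hW hS with ⟨hn₁, hn₂, hp⟩ | ⟨hn, hl⟩ | ⟨hn, hr⟩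
    · refine .inl ⟨hC₁.not_value hn₁, hC₂.not_value hn₂, ?_⟩
      intro d₁ S₁' K₁' ω₁ d₂ S₂' K₂' ω₂ hs₁ hs₂ hω
      obtain ⟨e₁', rfl, ht₁⟩ := hC₁.step hn₁ hs₁
      obtain ⟨e₂', rfl, ht₂⟩ := hC₂.step hn₂ hs₂
      obtain ⟨W'', hW', hS', hω', he'⟩ := hp _ _ _ _ _ _ _ _ ht₁ ht₂ hω
      exact ⟨W'', hW', hS', hω', next hW' he'⟩
    · refine .inr (.inl ⟨hC₁.not_value hn, fun d S' K'' ω hs => ?_⟩)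
      obtain ⟨e', rfl, ht⟩ := hC₁.step hn hs
      obtain ⟨hω, W'', hW', hS', he'⟩ := hl _ _ _ _ ht
      exact ⟨hω, W'', hW', hS', next hW' he'⟩
    · refine .inr (.inr ⟨hC₂.not_value hn, fun d S' K'' ω hs => ?_⟩)
      obtain ⟨e', rfl, ht⟩ := hC₂.step hn hs
      obtain ⟨hω, W'', hW', hS', he'⟩ := hr _ _ _ _ ht
      exact ⟨hω, W'', hW', hS', next hW' he'⟩

theorem BExp.weaken {Ko Ko' : Set Lock} (hK : K ⊆ Ko) (hK' : K' ⊆ Ko') (hKo : LockEquiv L A Ko Ko')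
    (hτ : ∀ {m W v v'}, BVal L A m τ W v v' → BVal L A m τ' W v v')
    (h : BExp L A m τ W K K' e₁ e₂) : BExp L A m τ' W Ko Ko' e₁ e₂ :=
  BExp.bind .hole .hole hK hK' hKo h fun _ _ _ _ _ _ hv => (hτ hv).bExp

theorem BExp.of_redex {d₁ d₂ : Expr Actor Lock} {ω : Obs Actor Lock} (hr₁ : IsPureRedex e₁ d₁ ω)
    (hr₂ : IsPureRedex e₂ d₂ ω) (hK : LockEquiv L A K K')
    (h : ∀ m' W', m' < m → W.Ext W' → BExp L A m' τ W' K K' d₁ d₂) :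
    BExp L A m τ W K K' e₁ e₂ := by
  refine BExp_iff.2 (.inl ⟨hK, fun K₁ K₂ _ _ _ W' k S₁ S₂ hk hW hS => .inl
    ⟨hr₁.not_value, hr₂.not_value, ?_⟩⟩)
  intro d₁ S₁' K₁' ω₁ d₂ S₂' K₂' ω₂ hs₁ hs₂ _
  obtain ⟨rfl, rfl, rfl⟩ := hr₁.step hs₁
  obtain ⟨rfl, rfl, rfl⟩ := hr₂.step hs₂
  exact ⟨W', .refl W', hS, .refl hr₁.not_write, h k W' hk hW⟩

theorem Sub.bVal (h : Sub τ τ') : ∀ {m : ℕ} {W : World Actor Lock} {v v' : Expr Actor Lock},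
    BVal L A m τ W v v' → BVal L A m τ' W v v' := by
  refine Sub.rec
    (motive_1 := fun B B' _ => ∀ {m W v v'}, BValA L A m B W v v' → BValA L A m B' W v v')
    (motive_2 := fun τ τ' _ => ∀ {m W v v'}, BVal L A m τ W v v' → BVal L A m τ' W v v')
    ?unit ?nat ?ref ?prod ?sum ?arrow ?ann h
  case unit => exact id
  case nat => exact id
  case ref => exact id
  case prod =>
    intro _ _ _ _ _ _ ih₁ ih₂ m W v v' h
    obtain ⟨v₁, v₂, v₁', v₂', rfl, rfl, h₁, h₂⟩ := BValA_prod.1 h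
    exact BValA_prod.2 ⟨v₁, v₂, v₁', v₂', rfl, rfl, ih₁ h₁, ih₂ h₂⟩
  case sum =>
    intro _ _ _ _ _ _ ih₁ ih₂ m W v v' h
    obtain ⟨w, w', rfl, rfl, hw⟩ | ⟨w, w', rfl, rfl, hw⟩ := BValA_sum.1 h
    · exact BValA_sum.2 (.inl ⟨w, w', rfl, rfl, ih₁ hw⟩)
    · exact BValA_sum.2 (.inr ⟨w, w', rfl, rfl, ih₂ hw⟩)
  case arrow =>
    intro _ _ _ _ _ _ _ _ hs₁ hs₂ hpc hK ih₁ ih₂ m W v v' h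
    obtain ⟨e, e', rfl, rfl, he, hu, hu'⟩ := BValA_arrow.1 h
    have hs := SubA.arrow hs₁ hs₂ hpc hK
    refine BValA_arrow.2 ⟨e, e', rfl, rfl, ?_, hs.uValA hu, hs.uValA hu'⟩
    intro W' k w w' K₁ K₂ hW hk hw hK₁ hK₂ hKK
    exact (he W' k w w' K₁ K₂ hW hk (ih₁ hw) (hK.trans hK₁) (hK.trans hK₂) hKK).weaken
      subset_rfl subset_rfl hKK ih₂
  case ann =>
    intro B B' P P' hP hB ih m W v v' h
    by_cases hA : P' ⊑ A.policy
    · exact (BVal_visible hA).2 (ih ((BVal_visible (hP.trans hA)).1 h))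
    · have hu := h.uVal
      rw [UVal_ann, UVal_ann] at hu
      exact BVal_ann.2 (.inr ⟨hA, hB.uValA hu.1, hB.uValA hu.2⟩)

/-- The release of a value by the locks in `K`: related values stay related at the more permissive
type if the attacker does not see this type or can open all the locks of `K` itself. -/
theorem BVal.release (h : BVal L A m τ' W v v') (hs : Sub (τ'.specialize K) τ)
    (hK : τ.policy ⊑ A.policy → K ⊆ A.locks) : BVal L A m τ W v v' := by
  by_cases hA : τ.policy ⊑ A.policy
  · cases τ' with
    | ann B' P' =>
    cases hs with
    | ann hP hB =>
      have hP' : P' ⊑ A.policy := Policy.le_attacker_of_specialize (hK hA) (hP.trans hA)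
      exact (BVal_visible hA).2 ((BVal_visible hP').1 ((Sub.ann (.refl P') hB).bVal h))
  · exact .of_invisible hA (hs.uVal (UVal_specialize.2 h.uVal.1))
      (hs.uVal (UVal_specialize.2 h.uVal.2))

/-- The values of two writes that have to be matched are related at the type of the location, even
if it was reached by a release: either irrelevance says so, or the attacker can open all the
locks that are active. -/
theorem BVal.release_of_irrel {w w' : Value Actor Lock} (h : BVal L A m τ' W w.1 w'.1)
    (hs : Sub (τ'.specialize K) τ) {l l' : Loc} {K₁ K₂ : Set Lock} (hK₁ : K ⊆ K₁) (hK₂ : K ⊆ K₂)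
    (hω : ObsIrrelWith L A (fun τ w w' => BVal L A m τ W w w') (.write l τ w) (.write l' τ w') ∨
      K₁ ⊆ A.locks ∨ K₂ ⊆ A.locks) : BVal L A m τ W w.1 w'.1 := by
  obtain hω | hA | hA := hω
  · cases hω with
    | refl hne => exact (hne _ _ _ rfl).elim
    | high hv =>
      exact h.release hs fun hA => (hv.elim (· (.of_write hA)) (· (.of_write hA))).elim
    | extend h => exact h
  · exact h.release hs fun _ => hK₁.trans hA
  · exact h.release hs fun _ => hK₂.trans hA

end Binary

/-! ### Compatibility of the binary relation with the language constructs -/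

section Compatibility

variable {L : Lock → Policy Actor Lock} {A : Attacker Actor Lock} {m : ℕ}
  {W W' : World Actor Lock} {pc P : Policy Actor Lock} {τ τ' τ₁ τ₂ : Ty Actor Lock}
  {K K' : Set Lock} {e₁ e₂ e₁' e₂' v v' w w' : Expr Actor Lock}

theorem BVal.isValue_left (h : BVal L A m τ W v v') : v.IsValue := h.uVal.1.isValue

theorem BVal.isValue_right (h : BVal L A m τ W v v') : v'.IsValue := h.uVal.2.isValue

theorem BExp.openedIn {σ : Lock} (hK : LockEquiv L A K K')
    (h : BExp L A m τ W (K ∪ {σ}) (K' ∪ {σ}) e₁ e₂) :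
    BExp L A m τ W K K' (.openedIn σ e₁) (.openedIn σ e₂) :=
  h.bind (.openedIn σ) (.openedIn σ) subset_rfl subset_rfl hK fun _ _ _ _ _ _ hv =>
    .of_redex (.openedIn σ hv.isValue_left) (.openedIn σ hv.isValue_right) hK
      fun _ _ hm hW => (hv.mono hm.le hW).bExp

theorem BExp.closedIn {σ : Lock} (hK : LockEquiv L A K K')
    (h : BExp L A m τ W (K \ {σ}) (K' \ {σ}) e₁ e₂) :
    BExp L A m τ W K K' (.closedIn σ e₁) (.closedIn σ e₂) :=
  h.bind (.closedIn σ) (.closedIn σ) subset_rfl subset_rfl hK fun _ _ _ _ _ _ hv =>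
    .of_redex (.closedIn σ hv.isValue_left) (.closedIn σ hv.isValue_right) hK
      fun _ _ hm hW => (hv.mono hm.le hW).bExp

theorem BExp.openIn {σ : Lock} (hK : LockEquiv L A K K')
    (h : BExp L A m τ W (K ∪ {σ}) (K' ∪ {σ}) e₁ e₂) :
    BExp L A m τ W K K' (.openIn σ e₁) (.openIn σ e₂) :=
  .of_redex (.openIn σ e₁) (.openIn σ e₂) hK fun _ _ hm hW => (h.mono hm.le hW).openedIn hK

theorem BExp.closeIn {σ : Lock} (hK : LockEquiv L A K K')
    (h : BExp L A m τ W (K \ {σ}) (K' \ {σ}) e₁ e₂) :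
    BExp L A m τ W K K' (.closeIn σ e₁) (.closeIn σ e₂) :=
  .of_redex (.closeIn σ e₁) (.closeIn σ e₂) hK fun _ _ hm hW => (h.mono hm.le hW).closedIn hK

/-- The components of related pairs. If the attacker cannot see the pairs, the components only lie
in the unary relation, which is enough at types that are at least as restrictive as the pair. -/
theorem BVal.prod_components
    (h : BVal L A m (.ann (.prod τ₁ τ₂) P) W v v') :
    ∃ v₁ v₂ v₁' v₂', v = .pair v₁ v₂ ∧ v' = .pair v₁' v₂' ∧
      (v₁.IsValue ∧ v₂.IsValue ∧ v₁'.IsValue ∧ v₂'.IsValue) ∧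
      (P ⊑ τ₁.policy → BVal L A m τ₁ W v₁ v₁') ∧ (P ⊑ τ₂.policy → BVal L A m τ₂ W v₂ v₂') := by
  obtain ⟨-, h⟩ | ⟨hP, h, h'⟩ := BVal_ann.1 h
  · obtain ⟨v₁, v₂, v₁', v₂', rfl, rfl, h₁, h₂⟩ := BValA_prod.1 h
    exact ⟨v₁, v₂, v₁', v₂', rfl, rfl,
      ⟨h₁.isValue_left, h₂.isValue_left, h₁.isValue_right, h₂.isValue_right⟩,
      fun _ => h₁, fun _ => h₂⟩
  · obtain ⟨v₁, v₂, rfl, h₁, h₂⟩ := UValA_prod.1 h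
    obtain ⟨v₁', v₂', rfl, h₁', h₂'⟩ := UValA_prod.1 h'
    exact ⟨v₁, v₂, v₁', v₂', rfl, rfl, ⟨h₁.isValue, h₂.isValue, h₁'.isValue, h₂'.isValue⟩,
      fun hle => .of_invisible (fun hA => hP (hle.trans hA)) h₁ h₁',
      fun hle => .of_invisible (fun hA => hP (hle.trans hA)) h₂ h₂'⟩

/-- Visible references correspond to each other, so their contents are related; the contents of
invisible ones are read at a type that is invisible as well. -/
theorem BVal.deref (hK : LockEquiv L A K K') (hP : P ⊑ τ'.policy) (hs : Sub τ τ')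
    (h : BVal L A m (.ann (.ref τ) P) W v v') :
    BExp L A m τ' W K K' (.deref v) (.deref v') := by
  obtain ⟨-, h⟩ | ⟨hA, hu⟩ := BVal_ann.1 h
  · obtain ⟨l, l', rfl, rfl, hl, hl', hβ⟩ := BValA_ref.1 h
    refine BExp_iff.2 (.inl ⟨hK, fun K₁ K₂ _ _ _ W' k S₁ S₂ hk hW hS => .inl ⟨nofun, nofun, ?_⟩⟩)
    intro d₁ S₁' K₁' ω₁ d₂ S₂' K₂' ω₂ hs₁ hs₂ _
    obtain ⟨w, _, hw, rfl, rfl, rfl⟩ := hs₁.deref_inv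
    obtain ⟨w', _, hw', rfl, rfl, rfl⟩ := hs₂.deref_inv
    exact ⟨W', .refl W', hS, .refl nofun,
      (hs.bVal (StateIndist.lookup hS (hW.2.2 hβ) (hW.1 _ _ hl) hw hw')).bExp⟩
  · have hτ : ¬ τ'.policy ⊑ A.policy := fun h => hA (hP.trans h)
    exact .of_uExp hA hK (.of_invisible hτ) ((h.uVal.1.deref).weaken (.refl P) hs.uVal)
      ((h.uVal.2.deref).weaken (.refl P) hs.uVal)

theorem BVal.new (hs : Sub (τ'.specialize K) τ) (h : BVal L A m τ' W v v') :
    BExp L A m (.ann (.ref τ) Policy.bot) W K K (.new v τ) (.new v' τ) := by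
  refine BExp_iff.2 (.inl ⟨.refl L A K, fun K₁ K₂ hK₁ hK₂ _ W₁ k S₁ S₂ hk hW hS => .inl
    ⟨nofun, nofun, ?_⟩⟩)
  intro d₁ S₁' K₁' ω₁ d₂ S₂' K₂' ω₂ hs₁ hs₂ hω
  obtain ⟨l, hl, rfl, rfl, rfl, rfl⟩ := hs₁.new_inv h.isValue_left
  obtain ⟨l', hl', rfl, rfl, rfl, rfl⟩ := hs₂.new_inv h.isValue_right
  have hθl := StateWF.env_eq_none hS.1 hl
  have hθl' := StateWF.env_eq_none hS.2.1 hl'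
  let W₂ := W₁.alloc l l' τ (fun k hk => (hS.2.2.1 _ hk).1 hθl) (fun k hk => (hS.2.2.1 _ hk).2 hθl')
  have hW₂ : W₁.Ext W₂ := ⟨Env.ext_update hθl τ, Env.ext_update hθl' τ, Set.subset_insert _ _⟩
  have hll : (l, l') ∈ W₂.β := Set.mem_insert _ _
  have hv := BVal.release_of_irrel (w := ⟨v, h.isValue_left⟩) (w' := ⟨v', h.isValue_right⟩)
    (h.mono hk.le hW) hs hK₁ hK₂ hω
  have hv := hv.mono le_rfl hW₂
  refine ⟨W₂, hW₂, ?_, .extend hv hll, BVal.bExp ?_⟩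
  · exact StateIndist.update hS hW₂ subset_rfl hll (Function.update_self ..)
      (Function.update_self ..) (fun _ h => Function.update_of_ne h ..)
      (fun _ h => Function.update_of_ne h ..) hv
  · exact BVal_bot.2 (BValA_ref.2 ⟨l, l', rfl, rfl, Function.update_self .., Function.update_self ..,
      hll⟩)

/-- Writes through a visible reference go to corresponding locations; writes through an invisible
one are invisible. -/
theorem BVal.assign (hs : Sub (τ'.specialize K) τ) (hP : P ⊑ τ.policy)
    (hr : BVal L A m (.ann (.ref τ) P) W v v') (h : BVal L A m τ' W w w') :
    BExp L A m (.ann .unit Policy.bot) W K K (.assign v w) (.assign v' w') := by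
  obtain ⟨-, hr⟩ | ⟨hA, -⟩ := BVal_ann.1 hr
  · obtain ⟨l, l', rfl, rfl, hl, hl', hβ⟩ := BValA_ref.1 hr
    refine BExp_iff.2 (.inl ⟨.refl L A K, fun K₁ K₂ hK₁ hK₂ _ W₁ k S₁ S₂ hk hW hS => .inl
      ⟨nofun, nofun, ?_⟩⟩)
    intro d₁ S₁' K₁' ω₁ d₂ S₂' K₂' ω₂ hs₁ hs₂ hω
    obtain ⟨_, _, hu, rfl, rfl, rfl, rfl⟩ := hs₁.assign_inv h.isValue_left
    obtain ⟨_, _, hu', rfl, rfl, rfl, rfl⟩ := hs₂.assign_inv h.isValue_right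
    have hl := hW.1 _ _ hl
    have hl' := hW.2.1 _ _ hl'
    have hll := hW.2.2 hβ
    obtain ⟨_, ht, -⟩ := StateWF.lookup hS.1 hl
    obtain ⟨_, ht', -⟩ := StateWF.lookup hS.2.1 hl'
    cases hu.symm.trans ht
    cases hu'.symm.trans ht'
    have hv := BVal.release_of_irrel (w := ⟨w, h.isValue_left⟩) (w' := ⟨w', h.isValue_right⟩)
      (h.mono hk.le hW) hs hK₁ hK₂ hω
    exact ⟨W₁, .refl W₁, StateIndist.update hS (.refl W₁) (Set.subset_insert _ _) hll hl hl'
      (fun _ _ => rfl) (fun _ _ => rfl) hv, .extend hv hll,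
      (BVal_bot.2 (BValA_unit.2 ⟨rfl, rfl⟩)).bExp⟩
  · have hs' {θ v} (h : UVal L m τ' θ v) : UVal L m τ θ v := hs.uVal (UVal_specialize.2 h)
    exact .of_uExp hA (.refl L A K) .of_unit (hr.uVal.1.assign hP (hs' h.uVal.1))
      (hr.uVal.2.assign hP (hs' h.uVal.2))

/-- Applications of related functions. At invisible functions, the bodies may differ, but they run
at an invisible program counter. -/
theorem BVal.app (hP : P ⊑ τ₂.policy) (hpc : P ⊑ pc) (hK : K' ⊆ K) {d d' : Expr Actor Lock}
    (hf : BVal L A m (.ann (.arrow K' pc τ₁ τ₂) P) W (.lam d) (.lam d'))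
    (h : BVal L A m τ₁ W w w') :
    BExp L A m τ₂ W K K (.app (.lam d) w) (.app (.lam d') w') := by
  obtain ⟨-, hf⟩ | ⟨hA, -⟩ := BVal_ann.1 hf
  · obtain ⟨_, _, ⟨⟩, ⟨⟩, hf, -⟩ := BValA_arrow.1 hf
    exact .of_redex (.app d h.isValue_left) (.app d' h.isValue_right) (.refl L A K)
      fun m' W' hm hW => hf W' m' w w' K K hW hm (h.mono hm.le hW) hK hK (.refl L A K)
  · exact .of_uExp (fun h => hA (hpc.trans h)) (.refl L A K)
      (.of_invisible fun h => hA (hP.trans h)) (hf.uVal.1.app_lam h.uVal.1)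
      (hf.uVal.2.app_lam h.uVal.2)

/-- The `when` construct on a visible lock: low equivalent lock sets select the same branch. -/
theorem BExp.whenOpen {σ : Lock} (hσ : L σ ⊑ A.policy) (hK : LockEquiv L A K K')
    (h₁ : BExp L A m τ W (K ∪ {σ}) (K' ∪ {σ}) e₁ e₁') (h₂ : BExp L A m τ W K K' e₂ e₂') :
    BExp L A m τ W K K' (.whenOpen σ e₁ e₂) (.whenOpen σ e₁' e₂') := by
  induction m using Nat.strong_induction_on generalizing W e₁ e₁' e₂ e₂' with
  | _ m ih =>
    refine BExp_iff.2 (.inl ⟨hK, fun K₁ K₂ hK₁ hK₂ hKK W' k S₁ S₂ hk hW hS => ?_⟩)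
    by_cases hσ₁ : σ ∈ K₁
    · have hσ₂ : σ ∈ K₂ := (hKK.mem_iff hσ).1 hσ₁
      have next {W'' d d'} (hW' : W'.Ext W'') (h : BExp L A k τ W'' (K ∪ {σ}) (K' ∪ {σ}) d d') :
          BExp L A k τ W'' K K' (.whenOpen σ d e₂) (.whenOpen σ d' e₂') :=
        ih k hk h (h₂.mono hk.le (hW.trans hW'))
      rcases BExp_iff.1 h₁ with ⟨-, hstep⟩ | hv
      · rcases hstep K₁ K₂ (Set.union_subset hK₁ (by simpa)) (Set.union_subset hK₂ (by simpa)) hKK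
          W' k S₁ S₂ hk hW hS with ⟨hn₁, hn₂, hp⟩ | ⟨hn, hl⟩ | ⟨hn, hr⟩
        · refine .inl ⟨nofun, nofun, ?_⟩
          intro d₁ S₁' K₁' ω₁ d₂ S₂' K₂' ω₂ hs₁ hs₂ hω
          obtain ⟨_, rfl, ht₁⟩ := (hs₁.whenOpen_inv_mem hσ₁).resolve_right fun h => hn₁ h.1
          obtain ⟨_, rfl, ht₂⟩ := (hs₂.whenOpen_inv_mem hσ₂).resolve_right fun h => hn₂ h.1
          obtain ⟨W'', hW', hS', hω', he'⟩ := hp _ _ _ _ _ _ _ _ ht₁ ht₂ hω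
          exact ⟨W'', hW', hS', hω', next hW' he'⟩
        · refine .inr (.inl ⟨nofun, fun d S' K'' ω hs => ?_⟩)
          obtain ⟨_, rfl, ht⟩ := (hs.whenOpen_inv_mem hσ₁).resolve_right fun h => hn h.1
          obtain ⟨hω, W'', hW', hS', he'⟩ := hl _ _ _ _ ht
          exact ⟨hω, W'', hW', hS', next hW' he'⟩
        · refine .inr (.inr ⟨nofun, fun d S' K'' ω hs => ?_⟩)
          obtain ⟨_, rfl, ht⟩ := (hs.whenOpen_inv_mem hσ₂).resolve_right fun h => hn h.1
          obtain ⟨hω, W'', hW', hS', he'⟩ := hr _ _ _ _ ht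
          exact ⟨hω, W'', hW', hS', next hW' he'⟩
      · refine .inl ⟨nofun, nofun, ?_⟩
        intro d₁ S₁' K₁' ω₁ d₂ S₂' K₂' ω₂ hs₁ hs₂ _
        obtain ⟨-, rfl, rfl, rfl⟩ := (hs₁.whenOpen_inv_mem hσ₁).resolve_left
          fun ⟨_, _, h⟩ => hv.isValue_left.not_step h
        obtain ⟨-, rfl, rfl, rfl⟩ := (hs₂.whenOpen_inv_mem hσ₂).resolve_left
          fun ⟨_, _, h⟩ => hv.isValue_right.not_step h
        exact ⟨W', .refl W', hS, .refl nofun, (hv.mono hk.le hW).bExp⟩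
    · have hσ₂ : σ ∉ K₂ := fun h => hσ₁ ((hKK.mem_iff hσ).2 h)
      have next {W'' d d'} (hW' : W'.Ext W'') (h : BExp L A k τ W'' K K' d d') :
          BExp L A k τ W'' K K' (.whenOpen σ e₁ d) (.whenOpen σ e₁' d') :=
        ih k hk (h₁.mono hk.le (hW.trans hW')) h
      rcases BExp_iff.1 h₂ with ⟨-, hstep⟩ | hv
      · rcases hstep K₁ K₂ hK₁ hK₂ hKK W' k S₁ S₂ hk hW hS with
          ⟨hn₁, hn₂, hp⟩ | ⟨hn, hl⟩ | ⟨hn, hr⟩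
        · refine .inl ⟨nofun, nofun, ?_⟩
          intro d₁ S₁' K₁' ω₁ d₂ S₂' K₂' ω₂ hs₁ hs₂ hω
          obtain ⟨_, rfl, ht₁⟩ := (hs₁.whenOpen_inv_not_mem hσ₁).resolve_right fun h => hn₁ h.1
          obtain ⟨_, rfl, ht₂⟩ := (hs₂.whenOpen_inv_not_mem hσ₂).resolve_right fun h => hn₂ h.1
          obtain ⟨W'', hW', hS', hω', he'⟩ := hp _ _ _ _ _ _ _ _ ht₁ ht₂ hω
          exact ⟨W'', hW', hS', hω', next hW' he'⟩
        · refine .inr (.inl ⟨nofun, fun d S' K'' ω hs => ?_⟩)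
          obtain ⟨_, rfl, ht⟩ := (hs.whenOpen_inv_not_mem hσ₁).resolve_right fun h => hn h.1
          obtain ⟨hω, W'', hW', hS', he'⟩ := hl _ _ _ _ ht
          exact ⟨hω, W'', hW', hS', next hW' he'⟩
        · refine .inr (.inr ⟨nofun, fun d S' K'' ω hs => ?_⟩)
          obtain ⟨_, rfl, ht⟩ := (hs.whenOpen_inv_not_mem hσ₂).resolve_right fun h => hn h.1
          obtain ⟨hω, W'', hW', hS', he'⟩ := hr _ _ _ _ ht
          exact ⟨hω, W'', hW', hS', next hW' he'⟩
      · refine .inl ⟨nofun, nofun, ?_⟩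
        intro d₁ S₁' K₁' ω₁ d₂ S₂' K₂' ω₂ hs₁ hs₂ _
        obtain ⟨-, rfl, rfl, rfl⟩ := (hs₁.whenOpen_inv_not_mem hσ₁).resolve_left
          fun ⟨_, _, h⟩ => hv.isValue_left.not_step h
        obtain ⟨-, rfl, rfl, rfl⟩ := (hs₂.whenOpen_inv_not_mem hσ₂).resolve_left
          fun ⟨_, _, h⟩ => hv.isValue_right.not_step h
        exact ⟨W', .refl W', hS, .refl nofun, (hv.mono hk.le hW).bExp⟩

end Compatibility

/-! ### Security of well-typed expressions -/

section Security

variable {L : Lock → Policy Actor Lock} {A : Attacker Actor Lock} {m m' : ℕ}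
  {Γ : List (Ty Actor Lock)} {W W' : World Actor Lock} {γ₁ γ₂ : ℕ → Expr Actor Lock}

theorem BCtx.uCtx_left (h : BCtx L A m Γ W γ₁ γ₂) : UCtx L m Γ W.θ₁ γ₁ :=
  fun x τ hx => (h x τ hx).uVal.1

theorem BCtx.uCtx_right (h : BCtx L A m Γ W γ₁ γ₂) : UCtx L m Γ W.θ₂ γ₂ :=
  fun x τ hx => (h x τ hx).uVal.2

theorem BCtx.mono (hm : m' ≤ m) (hW : W.Ext W') (h : BCtx L A m Γ W γ₁ γ₂) :
    BCtx L A m' Γ W' γ₁ γ₂ :=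
  fun x τ hx => (h x τ hx).mono hm hW

theorem BCtx.cons {τ : Ty Actor Lock} {v v' : Expr Actor Lock} (h : BCtx L A m Γ W γ₁ γ₂)
    (hv : BVal L A m τ W v v') : BCtx L A m (τ :: Γ) W (consSubst v γ₁) (consSubst v' γ₂) := by
  rintro (_ | x) τ' hx
  · obtain rfl : τ = τ' := by simpa using hx
    exact hv
  · exact h x τ' (by simpa using hx)

/-- The binary half of security: a well-typed expression is related to itself. -/
theorem HasType.bExp {K : Set Lock} {θ : Env Actor Lock} {pc : Policy Actor Lock}
    {e : Expr Actor Lock} {τ : Ty Actor Lock} (h : HasType L Γ K θ pc e τ) :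
    ∀ {m : ℕ} {W : World Actor Lock} {γ₁ γ₂ : ℕ → Expr Actor Lock}, (World.diag θ).Ext W →
      BCtx L A m Γ W γ₁ γ₂ → BExp L A m τ W K K (e.subst γ₁) (e.subst γ₂) := by
  induction h with
  | var hx => exact fun _ hγ => (hγ _ _ hx).bExp
  | unit => exact fun _ _ => (BVal_bot.2 (BValA_unit.2 ⟨rfl, rfl⟩)).bExp
  | @nat _ _ _ _ n => exact fun _ _ => (BVal_bot.2 (BValA_nat.2 ⟨n, rfl, rfl⟩)).bExp
  | @lam _ K _ pc _ _ _ _ _ h ih =>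
    intro m W γ₁ γ₂ hW hγ
    have hl : HasType _ _ K _ pc _ _ := .lam h
    refine (BVal_bot.2 (BValA_arrow.2 ⟨_, _, rfl, rfl, ?_,
      UVal_ann.1 ((hl.uExp hW.1 hγ.uCtx_left).uVal (.lam _)),
      UVal_ann.1 ((hl.uExp hW.2.1 hγ.uCtx_right).uVal (.lam _))⟩)).bExp
    intro W' k w w' K₁ K₂ hW' hk hw hK₁ hK₂ hKK
    rw [Expr.inst_subst_liftSubst, Expr.inst_subst_liftSubst]
    exact (ih (hW.trans hW') ((hγ.mono hk.le hW').cons hw)).weaken hK₁ hK₂ hKK id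
  | openIn _ _ ih => exact fun hW hγ => (ih hW hγ).openIn (.refl _ _ _)
  | openedIn _ _ ih => exact fun hW hγ => (ih hW hγ).openedIn (.refl _ _ _)
  | closeIn _ _ ih => exact fun hW hγ => (ih hW hγ).closeIn (.refl _ _ _)
  | closedIn _ _ ih => exact fun hW hγ => (ih hW hγ).closedIn (.refl _ _ _)
  | pair _ _ ih₁ ih₂ =>
    intro m W γ₁ γ₂ hW hγ
    refine (ih₁ hW hγ).bind (.pairL _) (.pairL _) subset_rfl subset_rfl (.refl _ _ _)
      fun m₁ W₁ v v' hm₁ hW₁ hv => ?_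
    refine (ih₂ (hW.trans hW₁) (hγ.mono hm₁ hW₁)).bind (.pairR hv.isValue_left)
      (.pairR hv.isValue_right) subset_rfl subset_rfl (.refl _ _ _) fun m₂ W₂ w w' hm₂ hW₂ hw => ?_
    exact (BVal_bot.2 (BValA_prod.2 ⟨v, w, v', w', rfl, rfl, hv.mono hm₂ hW₂, hw⟩)).bExp
  | fst _ hP ih =>
    intro m W γ₁ γ₂ hW hγ
    refine (ih hW hγ).bind .fst .fst subset_rfl subset_rfl (.refl _ _ _)
      fun m₁ W₁ v v' hm₁ hW₁ hv => ?_
    obtain ⟨v₁, v₂, v₁', v₂', rfl, rfl, ⟨hv₁, hv₂, hv₁', hv₂'⟩, h₁, -⟩ := hv.prod_components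
    exact .of_redex (.fst hv₁ hv₂) (.fst hv₁' hv₂') (.refl _ _ _)
      fun _ _ hm hW => ((h₁ hP).mono hm.le hW).bExp
  | snd _ hP ih =>
    intro m W γ₁ γ₂ hW hγ
    refine (ih hW hγ).bind .snd .snd subset_rfl subset_rfl (.refl _ _ _)
      fun m₁ W₁ v v' hm₁ hW₁ hv => ?_
    obtain ⟨v₁, v₂, v₁', v₂', rfl, rfl, ⟨hv₁, hv₂, hv₁', hv₂'⟩, -, h₂⟩ := hv.prod_components
    exact .of_redex (.snd hv₁ hv₂) (.snd hv₁' hv₂') (.refl _ _ _)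
      fun _ _ hm hW => ((h₂ hP).mono hm.le hW).bExp
  | inl _ ih =>
    exact fun hW hγ => (ih hW hγ).bind .inl .inl subset_rfl subset_rfl (.refl _ _ _)
      fun _ _ v v' _ _ hv => (BVal_bot.2 (BValA_sum.2 (.inl ⟨v, v', rfl, rfl, hv⟩))).bExp
  | inr _ ih =>
    exact fun hW hγ => (ih hW hγ).bind .inr .inr subset_rfl subset_rfl (.refl _ _ _)
      fun _ _ v v' _ _ hv => (BVal_bot.2 (BValA_sum.2 (.inr ⟨v, v', rfl, rfl, hv⟩))).bExp
  | @caseOf _ _ _ pc _ _ _ _ _ _ P _ hP h₁ h₂ ih ih₁ ih₂ =>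
    intro m W γ₁ γ₂ hW hγ
    refine (ih hW hγ).bind (.caseOf _ _) (.caseOf _ _) subset_rfl subset_rfl (.refl _ _ _)
      fun m₁ W₁ v v' hm₁ hW₁ hv => ?_
    have hW := hW.trans hW₁
    have hγ := hγ.mono hm₁ hW₁
    obtain ⟨-, hv⟩ | ⟨hA, -⟩ := BVal_ann.1 hv
    · obtain ⟨w, w', rfl, rfl, hw⟩ | ⟨w, w', rfl, rfl, hw⟩ := BValA_sum.1 hv
      · refine .of_redex (.caseL hw.isValue_left _ _) (.caseL hw.isValue_right _ _) (.refl _ _ _)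
          fun m₂ W₂ hm₂ hW₂ => ?_
        rw [Expr.inst_subst_liftSubst, Expr.inst_subst_liftSubst]
        exact ih₁ (hW.trans hW₂) ((hγ.mono hm₂.le hW₂).cons (hw.mono hm₂.le hW₂))
      · refine .of_redex (.caseR hw.isValue_left _ _) (.caseR hw.isValue_right _ _) (.refl _ _ _)
          fun m₂ W₂ hm₂ hW₂ => ?_
        rw [Expr.inst_subst_liftSubst, Expr.inst_subst_liftSubst]
        exact ih₂ (hW.trans hW₂) ((hγ.mono hm₂.le hW₂).cons (hw.mono hm₂.le hW₂))
    · -- The two runs may take different branches, whose effects and results are invisible.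
      have hpc : ¬ pc.join P ⊑ A.policy := fun h => hA ((Policy.le_join_right _ _).trans h)
      refine .of_uExp hpc (.refl _ _ _) (.of_invisible fun h => hA (hP.trans h))
        (hv.uVal.1.caseOf ?_ ?_) (hv.uVal.2.caseOf ?_ ?_)
      all_goals
        intro m₂ θ₂ w hm₂ hθ₂ hw
        rw [Expr.inst_subst_liftSubst]
      · exact h₁.uExp (hW.1.trans hθ₂) ((hγ.uCtx_left.mono hm₂ hθ₂).cons hw)
      · exact h₂.uExp (hW.1.trans hθ₂) ((hγ.uCtx_left.mono hm₂ hθ₂).cons hw)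
      · exact h₁.uExp (hW.2.1.trans hθ₂) ((hγ.uCtx_right.mono hm₂ hθ₂).cons hw)
      · exact h₂.uExp (hW.2.1.trans hθ₂) ((hγ.uCtx_right.mono hm₂ hθ₂).cons hw)
  | sub _ _ hs ih =>
    exact fun hW hγ => (ih hW hγ).weaken subset_rfl subset_rfl (.refl _ _ _) hs.bVal
  | app _ _ hP hpc hs hK ih₁ ih₂ =>
    intro m W γ₁ γ₂ hW hγ
    refine (ih₁ hW hγ).bind (.appL _) (.appL _) subset_rfl subset_rfl (.refl _ _ _)
      fun m₁ W₁ v v' hm₁ hW₁ hv => ?_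
    obtain ⟨d, rfl, -⟩ := UValA_arrow.1 (UVal_ann.1 hv.uVal.1)
    obtain ⟨d', rfl, -⟩ := UValA_arrow.1 (UVal_ann.1 hv.uVal.2)
    exact (ih₂ (hW.trans hW₁) (hγ.mono hm₁ hW₁)).bind (.appR d) (.appR d') subset_rfl subset_rfl
      (.refl _ _ _) fun m₂ W₂ w w' hm₂ hW₂ hw =>
        BVal.app hP ((Policy.le_join_right _ _).trans hpc) hK (hv.mono hm₂ hW₂) (hs.bVal hw)
  | deref _ hP hs ih =>
    exact fun hW hγ => (ih hW hγ).bind .deref .deref subset_rfl subset_rfl (.refl _ _ _)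
      fun _ _ _ _ _ _ hv => hv.deref (.refl _ _ _) hP hs
  | new _ _ hs ih =>
    exact fun hW hγ => (ih hW hγ).bind (.new _) (.new _) subset_rfl subset_rfl (.refl _ _ _)
      fun _ _ _ _ _ _ hv => hv.new hs
  | @loc _ _ _ _ l τ hl =>
    intro m W γ₁ γ₂ hW _
    refine (BVal_bot.2 (BValA_ref.2 ⟨l, l, rfl, rfl, hW.1 _ _ hl, hW.2.1 _ _ hl, ?_⟩)).bExp
    exact hW.2.2 ⟨rfl, by simp [hl]⟩
  | assign _ hs _ hpc ih₁ ih₂ =>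
    intro m W γ₁ γ₂ hW hγ
    refine (ih₁ hW hγ).bind (.assignL _) (.assignL _) subset_rfl subset_rfl (.refl _ _ _)
      fun m₁ W₁ v v' hm₁ hW₁ hv => ?_
    obtain ⟨l, rfl, -⟩ := UValA_ref.1 (UVal_ann.1 hv.uVal.1)
    obtain ⟨l', rfl, -⟩ := UValA_ref.1 (UVal_ann.1 hv.uVal.2)
    exact (ih₂ (hW.trans hW₁) (hγ.mono hm₁ hW₁)).bind (.assignR l) (.assignR l') subset_rfl
      subset_rfl (.refl _ _ _) fun m₂ W₂ w w' hm₂ hW₂ hw =>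
        (hv.mono hm₂ hW₂).assign hs ((Policy.le_join_right _ _).trans hpc) hw
  | @whenOpen _ _ _ pc σ _ _ _ h₁ h₂ hτ ih₁ ih₂ =>
    intro m W γ₁ γ₂ hW hγ
    by_cases hσ : L σ ⊑ A.policy
    · exact (ih₁ hW hγ).whenOpen hσ (.refl _ _ _) (ih₂ hW hγ)
    · -- The two runs may take different branches, whose effects and results are invisible.
      have hpc : ¬ pc.join (L σ) ⊑ A.policy := fun h => hσ ((Policy.le_join_right _ _).trans h)
      exact .of_uExp hpc (.refl _ _ _) (.of_invisible fun h => hσ (hτ.trans h))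
        ((h₁.uExp hW.1 hγ.uCtx_left).whenOpen (h₂.uExp hW.1 hγ.uCtx_left))
        ((h₁.uExp hW.2.1 hγ.uCtx_right).whenOpen (h₂.uExp hW.2.1 hγ.uCtx_right))

end Security

end WHR

theorem mainTheorem1 {Actor : Type u} {Lock : Type v}
    (L : Lock → WHR.Policy Actor Lock)
    (Γ : List (WHR.Ty Actor Lock)) (K : Set Lock) (θ : WHR.Env Actor Lock)
    (pc : WHR.Policy Actor Lock) (e : WHR.Expr Actor Lock) (τ : WHR.Ty Actor Lock)
    (h : WHR.HasType L Γ K θ pc e τ) :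
    WHR.Secure L Γ K θ pc e τ :=
  fun _ _ _ _ _ hW hγ =>
    ⟨h.bExp hW hγ, h.uExp hW.1 hγ.uCtx_left, h.uExp hW.2.1 hγ.uCtx_right⟩
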